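/- Theorem (discrepancy of kinetic halfspaces). A moving point in $\mathbb{R}^d$ is a map $p:[0,\infty)\to\mathbb{R}^d$, $p(t)=(x_1(t),\dots,x_d(t))$, whose coordinates are real polynomials in $t$; it has description complexity $s$ if every $x_j$ has degree at most $s$. For a finite set $P$ of moving points, let $H=(P,\mathcal{H}_d)$ be the kinetic hypergraph of halfspaces: its vertex set is $P$, and its hyperedges are the sets $\{p\in P : p(t)\in h\}$ for all times $t\ge 0$ and all (closed or open) halfspaces $h\subset\mathbb{R}^d$. Its discrepancy is $$\mathrm{disc}(H)=\min_{\chi:P\to\{-1,1\}}\ \max_{S}\ \Bigl|\sum_{p\in S}\chi(p)\Bigr| ,$$ where $S$ ranges over the hyperedges of $H$ (a maximum over the empty set is $0$). For all $d$ and $s$ there is a constant $C$, depending only on $d$ and $s$, such that for every $n$ and every set $P$ of $n$ moving points in $\mathbb{R}^d$ of description complexity $s$, the kinetic hypergraph $H=(P,\mathcal{H}_d)$ satisfies $$\mathrm{disc}(H)\le C\, n^{\frac12-\frac1{2d+2}} .$$ -/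

import Mathlib

namespace KineticDiscrepancy

/-! ### Discrepancy of a finite hypergraph -/

/-- The imbalance `χ(S) = ∑_{v ∈ S} χ(v)` of a finite set `S` of vertices under a 2-coloring with
values in `{1, -1} = ℤˣ`. -/
noncomputable def imbalance {α : Type*} (χ : α → ℤˣ) (S : Set α) : ℤ :=
  ∑ᶠ v ∈ S, (χ v : ℤ)

/-- The discrepancy `disc(H) = min_χ max_{S ∈ E(H)} |χ(S)|` of a hypergraph with finitely many
vertices. Colors of points outside the vertex set play no role, as all hyperedges are contained in
the vertex set. For finite `V(H)` both extrema are attained, see `disc_le_iff`. -/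
noncomputable def disc {α : Type*} (H : Hypergraph α) : ℕ :=
  ⨅ χ : α → ℤˣ, ⨆ S : H.edgeSet, (imbalance χ (S : Set α)).natAbs

/-- The defining property of the discrepancy: it is the least `k` such that some 2-coloring has
imbalance at most `k` on all hyperedges. -/
theorem disc_le_iff {α : Type*} {H : Hypergraph α} (hV : H.vertexSet.Finite) (k : ℕ) :
    disc H ≤ k ↔ ∃ χ : α → ℤˣ, ∀ S ∈ H.edgeSet, |imbalance χ S| ≤ (k : ℤ) := by
  have hE : H.edgeSet.Finite :=
    hV.finite_subsets.subset fun _ he => H.subset_vertexSet_of_mem_edgeSet' he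
  have : Finite H.edgeSet := hE
  have key : ∀ χ : α → ℤˣ, (⨆ S : H.edgeSet, (imbalance χ (S : Set α)).natAbs) ≤ k ↔
      ∀ S ∈ H.edgeSet, |imbalance χ S| ≤ (k : ℤ) := by
    intro χ
    have hb : BddAbove (Set.range fun S : H.edgeSet => (imbalance χ (S : Set α)).natAbs) :=
      (Set.finite_range _).bddAbove
    constructor
    · intro h S hS
      have h1 := (le_ciSup hb ⟨S, hS⟩).trans h
      rw [Int.abs_eq_natAbs]
      exact_mod_cast h1
    · intro h
      refine ciSup_le' fun S => ?_
      have := h S S.2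
      rw [Int.abs_eq_natAbs] at this
      exact_mod_cast this
  constructor
  · intro h
    obtain ⟨χ, hχ⟩ := Nat.sInf_mem (Set.range_nonempty fun χ : α → ℤˣ =>
      ⨆ S : H.edgeSet, (imbalance χ (S : Set α)).natAbs)
    exact ⟨χ, (key χ).1 (hχ.trans_le h)⟩
  · rintro ⟨χ, hχ⟩
    exact (ciInf_le (OrderBot.bddBelow _) χ).trans ((key χ).2 hχ)

/-! ### Moving points and kinetic hypergraphs -/

/-- A moving point `p(t) = (x_1(t), …, x_d(t))`, `t ∈ [0, ∞)`, in `ℝ^d` with polynomial coordinates.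
(A polynomial is determined by its values on `[0, ∞)`, so it is the same to give the polynomials or
the trajectory.) -/
abbrev MovingPoint (d : ℕ) : Type := Fin d → Polynomial ℝ

/-- The location `p(t) ∈ ℝ^d` of a moving point at time `t`. -/
noncomputable def MovingPoint.pos {d : ℕ} (p : MovingPoint d) (t : ℝ) : EuclideanSpace ℝ (Fin d) :=
  WithLp.toLp 2 fun j => (p j).eval t

/-- A moving point has description complexity `s` if all its coordinate polynomials have degree at
most `s`. -/
def MovingPoint.HasDescriptionComplexity {d : ℕ} (p : MovingPoint d) (s : ℕ) : Prop :=
  ∀ j, (p j).natDegree ≤ s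

/-- The kinetic hypergraph `(P, R)`: its vertices are the moving points in `P`, its hyperedges are
the sets of all those points of `P` that lie in a range `r ∈ R` at some time `t ≥ 0`. -/
def kineticHypergraph {d : ℕ} (P : Set (MovingPoint d))
    (R : Set (Set (EuclideanSpace ℝ (Fin d)))) : Hypergraph (MovingPoint d) where
  vertexSet := P
  edgeSet := {e | ∃ t : ℝ, 0 ≤ t ∧ ∃ r ∈ R, e = {p | p ∈ P ∧ p.pos t ∈ r}}
  subset_vertexSet_of_mem_edgeSet' := by
    rintro e ⟨t, -, r, -, rfl⟩ p hp
    exact hp.1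

/-- The family of all halfspaces in `ℝ^d`, closed and open. -/
def halfspaces (d : ℕ) : Set (Set (EuclideanSpace ℝ (Fin d))) :=
  {h | ∃ (a : EuclideanSpace ℝ (Fin d)) (b : ℝ), a ≠ 0 ∧
    (h = {x | inner ℝ a x ≤ b} ∨ h = {x | inner ℝ a x < b})}

end KineticDiscrepancy

/-! Two facts combine. First, time costs one degree of freedom: kinetic halfspaces have O(m^(d+1))
traces on m moving points. A trace at time t is a sign pattern of a linear functional on the vectors
(1, p(t)) in dimension d + 1. After a perturbation to general position, the cell of the functional
has an extreme ray orthogonal to d of these vectors, so the pattern is given by signs of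
determinants. These are polynomials in t of degree at most (d+1)s, and for a fixed d-tuple their
product has O(m) roots, which cut the time axis into O(m) intervals of constant signs
(`card_le_of_generic`, `exists_generic_perturbation`).

Second, Matoušek's theorem: a shatter function O(m^D) with D ≥ 2 gives discrepancy O(n^(1/2 -
1/(2D))); here D = d + 1. Haussler's packing lemma (`exists_net_const`) provides nets of size
O(16^(iD)) at distance n/16^i. Each set is a telescoping sum of differences between consecutive
nets, and these differences become small as they become numerous. The entropy method
(`exists_partial_coloring`) colors a constant fraction of the points and controls all differences at
once. Summing along the chain bounds the partial discrepancy, and repeating on the uncolored points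
gives a geometric series. -/

namespace KineticDiscrepancy

open Finset

/-! ### Haussler's packing lemma -/

section Packing

variable {β : Type*} [DecidableEq β]

/-- The edges in direction `i` of the unit distance graph of a set family, each represented by its
endpoint that does not contain `i`. -/
def unitEdges (i : β) (𝒜 : Finset (Finset β)) : Finset (Finset β) :=
  𝒜.nonMemberSubfamily i ∩ 𝒜.memberSubfamily i

theorem mem_unitEdges {i : β} {𝒜 : Finset (Finset β)} {S : Finset β} :
    S ∈ unitEdges i 𝒜 ↔ i ∉ S ∧ S ∈ 𝒜 ∧ insert i S ∈ 𝒜 := by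
  simp only [unitEdges, mem_inter, mem_nonMemberSubfamily, mem_memberSubfamily]
  tauto

theorem unitEdges_inter (i : β) (𝒜 ℬ : Finset (Finset β)) :
    unitEdges i (𝒜 ∩ ℬ) = unitEdges i 𝒜 ∩ unitEdges i ℬ := by
  ext S
  simp only [mem_unitEdges, mem_inter]
  tauto

theorem unitEdges_union_subset (i : β) (𝒜 ℬ : Finset (Finset β)) :
    unitEdges i 𝒜 ∪ unitEdges i ℬ ⊆ unitEdges i (𝒜 ∪ ℬ) := by
  intro S
  simp only [mem_unitEdges, mem_union]
  tauto

theorem card_unitEdges_eq {i x : β} (h : i ≠ x) (𝒜 : Finset (Finset β)) :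
    #(unitEdges i 𝒜) = #(unitEdges i (𝒜.memberSubfamily x)) +
      #(unitEdges i (𝒜.nonMemberSubfamily x)) := by
  rw [← card_memberSubfamily_add_card_nonMemberSubfamily x (unitEdges i 𝒜)]
  congr 2
  · ext S
    simp only [mem_memberSubfamily, mem_unitEdges, mem_insert, insert_comm i x S]
    have := h.symm
    tauto
  · ext S
    simp only [mem_nonMemberSubfamily, mem_unitEdges, mem_insert]
    have := h.symm
    tauto

theorem unitEdges_self (x : β) (𝒜 : Finset (Finset β)) :
    unitEdges x 𝒜 = 𝒜.memberSubfamily x ∩ 𝒜.nonMemberSubfamily x :=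
  inter_comm _ _

theorem notMem_of_shatters {x : β} {𝒜 : Finset (Finset β)} (h : ∀ S ∈ 𝒜, x ∉ S) {B : Finset β}
    (hB : 𝒜.Shatters B) : x ∉ B := by
  obtain ⟨u, hu, hBu⟩ := hB.exists_superset
  exact notMem_mono hBu (h u hu)

theorem shatters_of_shatters_union {x : β} {𝒜 : Finset (Finset β)} {B : Finset β}
    (hB : (𝒜.memberSubfamily x ∪ 𝒜.nonMemberSubfamily x).Shatters B) : 𝒜.Shatters B := by
  have hx : x ∉ B := notMem_of_shatters (fun S hS => by
    rcases mem_union.1 hS with h | h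
    · exact (mem_memberSubfamily.1 h).2
    · exact (mem_nonMemberSubfamily.1 h).2) hB
  intro t ht
  obtain ⟨u, hu, rfl⟩ := hB ht
  rcases mem_union.1 hu with h | h
  · exact ⟨insert x u, (mem_memberSubfamily.1 h).1, inter_insert_of_notMem hx⟩
  · exact ⟨u, (mem_nonMemberSubfamily.1 h).1, rfl⟩

/-- Every set of the intersection occurs in `𝒜` both with and without `x`, so `x` can be added to
anything it shatters. This is the drop in VC-dimension that drives the edge count below. -/
theorem shatters_insert_of_shatters_inter {x : β} {𝒜 : Finset (Finset β)} {B : Finset β}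
    (hB : (𝒜.memberSubfamily x ∩ 𝒜.nonMemberSubfamily x).Shatters B) :
    x ∉ B ∧ 𝒜.Shatters (insert x B) := by
  have hx : x ∉ B := notMem_of_shatters (fun S hS =>
    (mem_memberSubfamily.1 (mem_inter.1 hS).1).2) hB
  refine ⟨hx, fun t ht => ?_⟩
  obtain ⟨u, hu, hut⟩ := hB (t := t.erase x) (by rwa [subset_insert_iff] at ht)
  obtain ⟨h1, h2⟩ := mem_inter.1 hu
  rw [mem_memberSubfamily] at h1
  rw [mem_nonMemberSubfamily] at h2
  by_cases hxt : x ∈ t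
  · exact ⟨insert x u, h1.1, by rw [← insert_inter_distrib, hut, insert_erase hxt]⟩
  · exact ⟨u, h2.1, by rw [insert_inter_of_notMem h2.2, hut, erase_eq_of_notMem hxt]⟩

/-- A set family of VC-dimension at most `d` has at most `d |𝒜|` pairs of sets at distance one. -/
theorem sum_card_unitEdges_le (U : Finset β) : ∀ (d : ℕ) (𝒜 : Finset (Finset β)),
    (∀ S ∈ 𝒜, S ⊆ U) → (∀ B, 𝒜.Shatters B → #B ≤ d) → ∑ i ∈ U, #(unitEdges i 𝒜) ≤ d * #𝒜 := by
  induction U using Finset.induction_on with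
  | empty => intro d 𝒜 _ _; simp
  | insert x U hx ih =>
    intro d 𝒜 hU hd
    set M := 𝒜.memberSubfamily x
    set N := 𝒜.nonMemberSubfamily x
    have hMU : ∀ S ∈ M, S ⊆ U := fun S hS => by
      obtain ⟨h1, h2⟩ := mem_memberSubfamily.1 hS
      exact (subset_insert_iff_of_notMem h2).1 ((subset_insert _ _).trans (hU _ h1))
    have hNU : ∀ S ∈ N, S ⊆ U := fun S hS => by
      obtain ⟨h1, h2⟩ := mem_nonMemberSubfamily.1 hS
      exact (subset_insert_iff_of_notMem h2).1 (hU _ h1)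
    rw [sum_insert hx]
    have h1 : ∑ i ∈ U, #(unitEdges i 𝒜) ≤
        ∑ i ∈ U, #(unitEdges i (M ∪ N)) + ∑ i ∈ U, #(unitEdges i (M ∩ N)) := by
      rw [← sum_add_distrib]
      refine sum_le_sum fun i hi => ?_
      rw [card_unitEdges_eq (ne_of_mem_of_not_mem hi hx), ← card_union_add_card_inter,
        unitEdges_inter]
      exact Nat.add_le_add_right (card_le_card (unitEdges_union_subset _ _ _)) _
    have h2 : ∑ i ∈ U, #(unitEdges i (M ∪ N)) ≤ d * #(M ∪ N) :=
      ih d _ (fun S hS => (mem_union.1 hS).elim (hMU S) (hNU S))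
        fun B hB => hd B (shatters_of_shatters_union hB)
    -- The edges in direction `x` correspond to `M ∩ N`. They are paid for by the VC-dimension of `M
    -- ∩ N`, which is at most `d - 1`.
    have h3 : #(M ∩ N) + ∑ i ∈ U, #(unitEdges i (M ∩ N)) ≤ d * #(M ∩ N) := by
      have hB : ∀ B, (M ∩ N).Shatters B → #B + 1 ≤ d := fun B hB => by
        obtain ⟨h1, h2⟩ := shatters_insert_of_shatters_inter hB
        simpa [card_insert_of_notMem h1] using hd _ h2
      rcases (M ∩ N).eq_empty_or_nonempty with he | hne
      · simp [he, unitEdges, nonMemberSubfamily]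
      · have hd1 : 1 ≤ d := by simpa using hB ∅ (shatters_empty.2 hne)
        have := ih (d - 1) (M ∩ N) (fun S hS => hMU S (mem_inter.1 hS).1)
          fun B h => Nat.le_sub_one_of_lt (hB B h)
        obtain ⟨e, rfl⟩ : ∃ e, d = e + 1 := ⟨d - 1, by omega⟩
        simp only [Nat.add_sub_cancel] at this
        linarith
    rw [unitEdges_self]
    have hc : #𝒜 = #(M ∪ N) + #(M ∩ N) := by
      rw [card_union_add_card_inter, card_memberSubfamily_add_card_nonMemberSubfamily]
    rw [hc, mul_add]
    linarith

/-- Weighted version of `sum_card_unitEdges_le`. -/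
theorem sum_min_le [Fintype β] {d : ℕ} {𝒜 : Finset (Finset β)} (hd : ∀ B, 𝒜.Shatters B → #B ≤ d)
    (w : Finset β → ℕ) (hw : ∀ S, w S ≠ 0 → S ∈ 𝒜) :
    ∑ i, ∑ S with i ∉ S, min (w S) (w (insert i S)) ≤ d * ∑ S, w S := by
  obtain ⟨K, hK⟩ : ∃ K, ∀ S, w S ≤ K := ⟨∑ S, w S, fun S => single_le_sum (f := w)
    (fun _ _ => Nat.zero_le _) (mem_univ S)⟩
  -- Layer-cake decomposition: each superlevel set of `w` is a subfamily of `𝒜`, to which the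
  -- unweighted bound applies.
  have layer : ∀ k ≤ K, k = ∑ t ∈ Finset.range K, if t < k then 1 else 0 := fun k hk => by
    rw [← card_filter]
    conv_lhs => rw [← card_range k]
    congr 1
    ext t
    simp only [mem_range, mem_filter]
    omega
  have h1 : ∑ S, w S = ∑ t ∈ Finset.range K, #{S | t < w S} := by
    simp_rw [card_filter]
    rw [sum_comm]
    exact sum_congr rfl fun S _ => layer _ (hK S)
  have h2 : ∑ i, ∑ S with i ∉ S, min (w S) (w (insert i S)) =
      ∑ t ∈ Finset.range K, ∑ i, #(unitEdges i {S | t < w S}) := by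
    rw [sum_comm]
    refine sum_congr rfl fun i _ => ?_
    have : ∀ t, #(unitEdges i {S | t < w S}) =
        ∑ S with i ∉ S, if t < min (w S) (w (insert i S)) then 1 else 0 := by
      intro t
      rw [← card_filter, filter_filter]
      congr 1
      ext S
      simp [mem_unitEdges]
    rw [sum_congr rfl fun t _ => this t]
    rw [sum_comm]
    exact sum_congr rfl fun S _ => layer _ ((min_le_left _ _).trans (hK S))
  rw [h1, h2, mul_sum]
  refine sum_le_sum fun t _ => sum_card_unitEdges_le univ d _ (fun _ _ => subset_univ _) fun B hB =>
    hd B (hB.mono_left fun S hS => hw S ?_)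
  simp only [mem_filter] at hS
  omega

end Packing

end KineticDiscrepancy

namespace KineticDiscrepancy

open Finset

/-! ### Random samples and well separated families -/

section Sampling

/-- Resampling one coordinate preserves the uniform distribution: exchanging `x` with `a i` is an
involution on pairs. -/
theorem sum_sum_update {α : Type*} [Fintype α] {m : ℕ} (i : Fin m) (g : (Fin m → α) → ℝ) :
    ∑ a, ∑ x, g (Function.update a i x) = Fintype.card α * ∑ a, g a := by
  have h : ∑ p : (Fin m → α) × α, g (Function.update p.1 i p.2) =
      ∑ p : (Fin m → α) × α, g p.1 := by
    refine sum_nbij' (fun p => (Function.update p.1 i p.2, p.1 i))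
      (fun p => (Function.update p.1 i p.2, p.1 i)) ?_ ?_ ?_ ?_ ?_ <;> simp
  rw [Fintype.sum_prod_type, Fintype.sum_prod_type] at h
  simpa [mul_sum] using h

variable {α : Type*} [DecidableEq α]

/-- The trace of a set on a sequence of points. -/
def trace {m : ℕ} (a : Fin m → α) (S : Finset α) : Finset (Fin m) := {i | a i ∈ S}

@[simp] theorem mem_trace {m : ℕ} {a : Fin m → α} {S : Finset α} {i : Fin m} :
    i ∈ trace a S ↔ a i ∈ S := by simp [trace]

/-- The (primal) shatter function of the family `F` is bounded by `c (m + 1) ^ D`. -/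
def ShatterBound (F : Finset (Finset α)) (c D : ℕ) : Prop :=
  ∀ (m : ℕ) (a : Fin m → α), #(F.image (trace a)) ≤ c * (m + 1) ^ D

theorem ShatterBound.mono {F G : Finset (Finset α)} {c D : ℕ} (h : ShatterBound F c D)
    (hG : G ⊆ F) : ShatterBound G c D := fun m a =>
  (card_le_card (image_subset_image hG)).trans (h m a)

/-- Shattering `d + 1` indices would produce all `2 ^ (d + 1)` traces on a sample of that length,
more than the shatter function allows. -/
theorem ShatterBound.card_le_of_shatters {F : Finset (Finset α)} {c D d : ℕ}
    (h : ShatterBound F c D) (hd : c * (d + 2) ^ D < 2 ^ (d + 1)) {m : ℕ} (a : Fin m → α)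
    (B : Finset (Fin m)) (hB : (F.image (trace a)).Shatters B) : #B ≤ d := by
  by_contra! hlt
  obtain ⟨B', hB', hcard⟩ := exists_subset_card_eq (Nat.succ_le_of_lt hlt)
  have hs := hB.mono_right hB'
  set e := B'.orderEmbOfFin hcard
  have huniv : (univ : Finset (Finset (Fin (d + 1)))) ⊆ F.image (trace (a ∘ e)) := by
    intro T _
    have hT : T.map e.toEmbedding ⊆ B' := by
      intro i hi
      obtain ⟨j, -, rfl⟩ := mem_map.1 hi
      exact orderEmbOfFin_mem _ _ _
    obtain ⟨u, hu, hut⟩ := hs hT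
    obtain ⟨S, hS, rfl⟩ := mem_image.1 hu
    refine mem_image.2 ⟨S, hS, ?_⟩
    ext j
    have h1 : e j ∈ B' ∩ trace a S ↔ e j ∈ T.map e.toEmbedding := by rw [hut]
    rw [mem_inter, mem_trace, and_iff_right (orderEmbOfFin_mem _ _ _)] at h1
    rw [mem_trace, Function.comp_apply, h1]
    simp
  have := (card_le_card huniv).trans (h _ _)
  rw [card_univ, Fintype.card_finset, Fintype.card_fin] at this
  exact absurd this (not_le.2 hd)

theorem trace_update {m : ℕ} (a : Fin m → α) (i : Fin m) (x : α) (S : Finset α) :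
    trace (Function.update a i x) S =
      if x ∈ S then insert i ((trace a S).erase i) else (trace a S).erase i := by
  ext j
  by_cases hj : j = i
  · subst hj; by_cases hx : x ∈ S <;> simp [hx]
  · by_cases hx : x ∈ S <;> simp [hx, hj]

/-- A random point splits a family of well separated sets evenly. -/
theorem le_sum_min_card [Fintype α] {δ : ℝ} {C : Finset (Finset α)}
    (hC : ∀ S ∈ C, ∀ T ∈ C, S ≠ T → δ ≤ #(symmDiff S T)) :
    δ / 2 * ((#C : ℝ) - if C.Nonempty then 1 else 0) ≤
      ∑ x, (min #{S ∈ C | x ∉ S} #{S ∈ C | x ∈ S} : ℕ) := by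
  rcases C.eq_empty_or_nonempty with rfl | hne
  · simp
  rw [if_pos hne]
  have hpos : (0 : ℝ) < #C := by exact_mod_cast hne.card_pos
  -- The product counts ordered pairs separated by `x`, so its sum over `x` is governed by the
  -- pairwise distances in `C`.
  have h1 : ∀ x : α, (#{S ∈ C | x ∉ S} : ℝ) * #{S ∈ C | x ∈ S} ≤
      #C * (min #{S ∈ C | x ∉ S} #{S ∈ C | x ∈ S} : ℕ) := fun x => by
    rw [← card_filter_add_card_filter_not (s := C) (fun S => x ∈ S)]
    set b := #{S ∈ C | x ∉ S}
    set b' := #{S ∈ C | x ∈ S}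
    norm_cast
    rcases le_total b b' with h | h
    · rw [min_eq_left h]; nlinarith
    · rw [min_eq_right h]; nlinarith
  have h2 : ∑ x : α, (#{S ∈ C | x ∉ S} : ℝ) * #{S ∈ C | x ∈ S} =
      ∑ S ∈ C, ∑ T ∈ C, (#(T \ S) : ℝ) := by
    have : ∀ x : α, (#{S ∈ C | x ∉ S} : ℝ) * #{S ∈ C | x ∈ S} =
        ∑ S ∈ C, ∑ T ∈ C, if x ∈ T \ S then 1 else 0 := fun x => by
      rw [card_filter, card_filter]
      push_cast
      rw [sum_mul_sum]
      refine sum_congr rfl fun S _ => sum_congr rfl fun T _ => ?_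
      by_cases h : x ∈ S <;> by_cases h' : x ∈ T <;> simp [h, h']
    rw [sum_congr rfl fun x _ => this x, sum_comm]
    refine sum_congr rfl fun S _ => ?_
    rw [sum_comm]
    refine sum_congr rfl fun T _ => ?_
    rw [sum_boole, filter_mem_eq_inter, univ_inter]
  have h3 : δ * (#C * (#C - 1)) ≤ 2 * ∑ S ∈ C, ∑ T ∈ C, (#(T \ S) : ℝ) := by
    have hsymm : 2 * ∑ S ∈ C, ∑ T ∈ C, (#(T \ S) : ℝ) =
        ∑ S ∈ C, ∑ T ∈ C, (#(symmDiff S T) : ℝ) := by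
      rw [two_mul]
      nth_rewrite 1 [sum_comm]
      rw [← sum_add_distrib]
      refine sum_congr rfl fun S _ => ?_
      rw [← sum_add_distrib]
      refine sum_congr rfl fun T _ => ?_
      rw [symmDiff, sup_eq_union, card_union_of_disjoint disjoint_sdiff_sdiff]
      push_cast
      rfl
    have hS : ∀ S ∈ C, δ * (#C - 1) ≤ ∑ T ∈ C, (#(symmDiff S T) : ℝ) := fun S hS => by
      rw [← add_sum_erase _ _ hS]
      have h4 : ∑ T ∈ C.erase S, δ ≤ ∑ T ∈ C.erase S, (#(symmDiff S T) : ℝ) :=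
        sum_le_sum fun T hT => hC S hS T (mem_of_mem_erase hT) (ne_of_mem_erase hT).symm
      rw [sum_const, nsmul_eq_mul, card_erase_of_mem hS, Nat.cast_pred hne.card_pos] at h4
      have h5 : (0 : ℝ) ≤ #(symmDiff S S) := Nat.cast_nonneg _
      linarith
    rw [hsymm]
    have := sum_le_sum hS
    rw [sum_const, nsmul_eq_mul] at this
    linarith
  have h4 := sum_le_sum fun x (_ : x ∈ (univ : Finset α)) => h1 x
  rw [h2, ← mul_sum] at h4
  push_cast at h4 ⊢
  have h5 : #C * (δ / 2 * ((#C : ℝ) - 1)) ≤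
      #C * ∑ x, min (#{S ∈ C | x ∉ S} : ℝ) #{S ∈ C | x ∈ S} := by linarith
  exact le_of_mul_le_mul_left h5 hpos

/-- Haussler's packing lemma, in terms of the sample size. -/
theorem ShatterBound.card_le_of_separated [Fintype α] {F : Finset (Finset α)} {c D d m : ℕ} {δ : ℝ}
    (h : ShatterBound F c D) (hd : c * (d + 2) ^ D < 2 ^ (d + 1)) (hδ : 0 < δ) (hm0 : 0 < m)
    (hm : 4 * d * Fintype.card α ≤ m * δ)
    (hF : ∀ S ∈ F, ∀ T ∈ F, S ≠ T → δ ≤ #(symmDiff S T)) :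
    #F ≤ 2 * (c * (m + 1) ^ D) := by
  set w : (Fin m → α) → Finset (Fin m) → ℕ := fun a Q => #{S ∈ F | trace a S = Q}
  -- For every fixed sample, the traces have VC-dimension at most `d`, which bounds the weight of
  -- all unit edges from above.
  have hup : ∀ a : Fin m → α, ∑ i, ∑ Q with i ∉ Q, min (w a Q) (w a (insert i Q)) ≤ d * #F := by
    intro a
    refine (sum_min_le (fun B hB => h.card_le_of_shatters hd a B hB) (w a) ?_).trans_eq ?_
    · intro Q hQ
      obtain ⟨S, hS⟩ := card_ne_zero.1 hQ
      rw [mem_filter] at hS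
      exact mem_image.2 ⟨S, hS⟩
    · congr 1
      exact (card_eq_sum_card_fiberwise fun _ _ => mem_univ _).symm
  -- Fix the sample except at `i` and group `F` by the trace off `i`. A random point at `i` splits
  -- each group evenly; the loss of one set per group is bounded by the number of traces.
  have hlow : ∀ (i : Fin m) (a : Fin m → α), δ / 2 * (#F - c * (m + 1) ^ D) ≤
      ∑ x, ((∑ Q with i ∉ Q, min (w (Function.update a i x) Q)
        (w (Function.update a i x) (insert i Q)) : ℕ) : ℝ) := by
    intro i a
    set C : Finset (Fin m) → Finset (Finset α) := fun Q => {S ∈ F | (trace a S).erase i = Q}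
    have hw : ∀ Q, i ∉ Q → ∀ x, w (Function.update a i x) Q = #{S ∈ C Q | x ∉ S} ∧
        w (Function.update a i x) (insert i Q) = #{S ∈ C Q | x ∈ S} := by
      intro Q hQ x
      constructor
      · simp only [w, C, filter_filter]
        congr 1
        refine filter_congr fun S _ => ?_
        rw [trace_update]
        by_cases hx : x ∈ S
        · simp only [hx, if_true, not_true, and_false, iff_false]
          rintro rfl
          exact hQ (mem_insert_self _ _)
        · simp [hx]
      · simp only [w, C, filter_filter]
        congr 1
        refine filter_congr fun S _ => ?_
        rw [trace_update]
        by_cases hx : x ∈ S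
        · simp only [hx, if_true, and_true]
          constructor
          · intro he
            rw [← erase_insert (notMem_erase i (trace a S)), he, erase_insert hQ]
          · rintro rfl; rfl
        · simp only [hx, if_false, and_false, iff_false]
          intro he
          exact notMem_erase i _ (he ▸ mem_insert_self i Q)
    have h1 : ∑ x, ((∑ Q with i ∉ Q, min (w (Function.update a i x) Q)
        (w (Function.update a i x) (insert i Q)) : ℕ) : ℝ) =
        ∑ Q with i ∉ Q, ((∑ x, min #{S ∈ C Q | x ∉ S} #{S ∈ C Q | x ∈ S} : ℕ) : ℝ) := by
      simp_rw [Nat.cast_sum (R := ℝ) univ]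
      rw [sum_comm]
      refine sum_congr rfl fun x _ => ?_
      rw [Nat.cast_sum]
      refine sum_congr rfl fun Q hQ => ?_
      rw [(hw Q (mem_filter.1 hQ).2 x).1, (hw Q (mem_filter.1 hQ).2 x).2]
    rw [h1]
    refine le_trans ?_ (sum_le_sum fun Q _ => le_sum_min_card (δ := δ) (C := C Q) fun S hS T hT =>
      hF S (mem_filter.1 hS).1 T (mem_filter.1 hT).1)
    rw [← mul_sum, sum_sub_distrib]
    refine mul_le_mul_of_nonneg_left (sub_le_sub (le_of_eq ?_) ?_) (by positivity)
    · rw [card_eq_sum_card_fiberwise (f := fun S => (trace a S).erase i)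
        (t := {Q | i ∉ Q}) fun S _ => by simp]
      push_cast
      rfl
    · have h2 : ∑ Q with i ∉ Q, (if (C Q).Nonempty then (1 : ℝ) else 0) ≤
          #((F.image (trace a)).image fun Q => Q.erase i) := by
        rw [← sum_filter, sum_const, nsmul_eq_mul, mul_one]
        refine Nat.cast_le.2 (card_le_card fun Q hQ => ?_)
        obtain ⟨S, hS⟩ := (mem_filter.1 hQ).2
        rw [mem_filter] at hS
        exact mem_image.2 ⟨_, mem_image_of_mem _ hS.1, hS.2⟩
      refine h2.trans ?_
      exact_mod_cast card_image_le.trans (h m a)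
  by_contra! hlt
  have hltR : (2 * (c * (m + 1) ^ D) : ℝ) < #F := by exact_mod_cast hlt
  have hcD : (0 : ℝ) ≤ c * (m + 1) ^ D := by positivity
  have hFpos : (0 : ℝ) < #F := by linarith
  have hα : Nonempty α := by
    by_contra hemp
    rw [not_nonempty_iff] at hemp
    have h1 : #F ≤ 1 := card_le_one.2 fun S _ T _ => Subsingleton.elim S T
    have h2 := h 0 Fin.elim0
    have h3 : (F.image (trace Fin.elim0)).Nonempty :=
      (card_pos.1 (by exact_mod_cast hFpos)).image _
    have h4 : 1 ≤ c := by
      have := h3.card_pos.trans_le h2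
      simp at this
      omega
    have h5 : 1 ≤ (m + 1) ^ D := Nat.one_le_pow _ _ (by omega)
    have h6 := Nat.mul_le_mul h4 h5
    omega
  have hn : (0 : ℝ) < Fintype.card α := by exact_mod_cast Fintype.card_pos
  set W : (Fin m → α) → Fin m → ℝ := fun a i =>
    ((∑ Q with i ∉ Q, min (w a Q) (w a (insert i Q)) : ℕ) : ℝ)
  have hA : (0 : ℝ) < Fintype.card (Fin m → α) := by exact_mod_cast Fintype.card_pos
  have h1 : ∑ a, ∑ i, W a i ≤ Fintype.card (Fin m → α) * (d * #F) := by
    rw [← nsmul_eq_mul, ← Finset.card_univ, ← sum_const]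
    refine sum_le_sum fun a _ => ?_
    have := hup a
    simp only [W]
    exact_mod_cast this
  have h2 : (m : ℝ) * (Fintype.card (Fin m → α) * (δ / 2 * (#F - c * (m + 1) ^ D))) ≤
      Fintype.card α * ∑ a, ∑ i, W a i := by
    rw [sum_comm, mul_sum]
    have : ∀ i : Fin m, (Fintype.card (Fin m → α) * (δ / 2 * (#F - c * (m + 1) ^ D)) : ℝ) ≤
        Fintype.card α * ∑ a, W a i := fun i => by
      rw [← sum_sum_update i fun a => W a i, ← nsmul_eq_mul, ← Finset.card_univ, ← sum_const]
      exact sum_le_sum fun a _ => hlow i a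
    have h3 := sum_le_sum fun i (_ : i ∈ (univ : Finset (Fin m))) => this i
    rwa [sum_const, nsmul_eq_mul, card_univ, Fintype.card_fin] at h3
  have h3 : (Fintype.card (Fin m → α) : ℝ) * (m * (δ / 2 * (#F - c * (m + 1) ^ D))) ≤
      Fintype.card (Fin m → α) * (Fintype.card α * (d * #F)) := by
    nlinarith [mul_le_mul_of_nonneg_left h1 hn.le]
  have h4 := le_of_mul_le_mul_left h3 hA
  have hmR : (0 : ℝ) < m := by exact_mod_cast hm0
  -- By the choice of `m`, the upper bound `n d #F`, with `n` the size of `α`, is at most a quarter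
  -- of `m δ #F`, while the lower bound is half of `m δ (#F - c (m + 1) ^ D)`.
  have h5 : (m : ℝ) * δ * (#F - 2 * (c * (m + 1) ^ D)) ≤ 0 := by
    have := mul_le_mul_of_nonneg_right hm hFpos.le
    nlinarith
  have h6 : 0 < (m : ℝ) * δ * (#F - 2 * (c * (m + 1) ^ D)) :=
    mul_pos (mul_pos hmR hδ) (by linarith)
  linarith

end Sampling

end KineticDiscrepancy

/-! ### Nets of bounded size for the symmetric difference distance -/

namespace KineticDiscrepancy

open Finset

theorem exists_mul_pow_lt_two_pow (c D : ℕ) : ∃ d : ℕ, c * (d + 2) ^ D < 2 ^ (d + 1) := by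
  have h := (tendsto_pow_const_div_const_pow_of_one_lt D (r := (2 : ℝ)) (by norm_num)).const_mul
    (c : ℝ)
  rw [mul_zero] at h
  have h2 := h.eventually (gt_mem_nhds (show (0 : ℝ) < 1 / 2 by norm_num))
  obtain ⟨n, hn, hn2⟩ := (h2.and (Filter.eventually_ge_atTop 2)).exists
  obtain ⟨d, rfl⟩ : ∃ d, n = d + 2 := ⟨n - 2, by omega⟩
  refine ⟨d, ?_⟩
  rw [← mul_div_assoc, div_lt_iff₀ (by positivity)] at hn
  have h3 : (c * (d + 2) ^ D : ℝ) < 2 ^ (d + 1) := by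
    push_cast at hn
    calc _ < 1 / 2 * (2 : ℝ) ^ (d + 2) := hn
      _ = _ := by ring
  exact_mod_cast h3

/-- Haussler's packing lemma. -/
theorem exists_net_const (c D : ℕ) : ∃ K : ℝ, 0 < K ∧ ∀ {α : Type*} [Fintype α] [DecidableEq α]
    (F : Finset (Finset α)) (_ : ShatterBound F c D) (δ : ℝ) (_ : 0 < δ) (_ : δ ≤ Fintype.card α),
    ∃ G ⊆ F, (#G : ℝ) ≤ K * (Fintype.card α / δ) ^ D ∧
      ∀ S ∈ F, ∃ T ∈ G, (#(symmDiff S T) : ℝ) < δ := by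
  obtain ⟨d, hd⟩ := exists_mul_pow_lt_two_pow c D
  -- The sample size `m = ⌈4dn/δ⌉ + 1` satisfies `m + 1 ≤ (4d + 3) n/δ`, as `n/δ ≥ 1`. The final `+
  -- 1` keeps the constant positive when `c = 0`.
  refine ⟨2 * c * (4 * d + 3) ^ D + 1, by positivity, ?_⟩
  intro α _ _ F hF δ hδ hδn
  set sep : Finset (Finset α) → Prop := fun G =>
    ∀ S ∈ G, ∀ T ∈ G, S ≠ T → δ ≤ (#(symmDiff S T) : ℝ)
  classical
  -- A largest separated subfamily is a net: a set far from all its members could be added.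
  obtain ⟨G, hG, hmax⟩ := exists_max_image (F.powerset.filter sep) card
    ⟨∅, by simp [sep]⟩
  rw [mem_filter, mem_powerset] at hG
  refine ⟨G, hG.1, ?_, ?_⟩
  · set n : ℝ := (Fintype.card α : ℝ)
    have hn1 : 1 ≤ n / δ := (one_le_div hδ).2 hδn
    obtain ⟨m, hm0⟩ : ∃ m, m = ⌈4 * d * n / δ⌉₊ + 1 := ⟨_, rfl⟩
    have hcast : (m : ℝ) = ⌈4 * d * n / δ⌉₊ + 1 := by simp [hm0]
    have hm : 4 * d * n / δ ≤ m :=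
      (Nat.le_ceil _).trans (by rw [hcast]; linarith)
    have h := (hF.mono hG.1).card_le_of_separated hd hδ (by omega : 0 < m)
      (by rwa [div_le_iff₀ hδ] at hm) hG.2
    have hmle : (m : ℝ) + 1 ≤ (4 * d + 3) * (n / δ) := by
      have := Nat.ceil_lt_add_one (show 0 ≤ 4 * d * n / δ by positivity)
      have he : 4 * d * n / δ = 4 * d * (n / δ) := by ring
      rw [hcast]
      nlinarith
    have hR : (#G : ℝ) ≤ 2 * (c * (m + 1) ^ D) := by exact_mod_cast h
    have h2 : ((m : ℝ) + 1) ^ D ≤ (4 * d + 3) ^ D * (n / δ) ^ D := by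
      rw [← mul_pow]
      exact pow_le_pow_left₀ (by positivity) hmle _
    have h3 : (0 : ℝ) ≤ (n / δ) ^ D := by positivity
    have h4 := mul_le_mul_of_nonneg_left h2 (show (0 : ℝ) ≤ 2 * c by positivity)
    nlinarith
  · intro S hS
    by_contra! hfar
    have hSG : S ∉ G := fun h => by
      have := hfar S h
      simp at this
      linarith
    have h1 := hmax (insert S G) (mem_filter.2 ⟨mem_powerset.2 (insert_subset hS hG.1), ?_⟩)
    · rw [card_insert_of_notMem hSG] at h1
      omega
    · intro A hA B hB hAB
      rcases mem_insert.1 hA with rfl | hA' <;> rcases mem_insert.1 hB with rfl | hB'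
      · exact absurd rfl hAB
      · exact hfar B hB'
      · rw [symmDiff_comm]
        exact hfar A hA'
      · exact hG.2 A hA' B hB' hAB

end KineticDiscrepancy

namespace KineticDiscrepancy

open Finset Real

/-! ### The entropy method -/

section Entropy

/-- Gibbs' inequality gives a large fibre of a map of small cross entropy. -/
theorem exists_large_fiber {Ω B : Type*} [Fintype Ω] [Nonempty Ω] [DecidableEq B] (b : Ω → B)
    (Q : B → ℝ) (hQ : ∀ k, 0 < Q k) (hsum : ∑ k ∈ univ.image b, Q k ≤ 1) {E : ℝ}
    (hE : ∑ ω, -log (Q (b ω)) ≤ Fintype.card Ω * E) :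
    ∃ ω, Fintype.card Ω * exp (-E) ≤ #{ω' | b ω' = b ω} := by
  by_contra! hlt
  have hΩ : (0 : ℝ) < Fintype.card Ω := by exact_mod_cast Fintype.card_pos
  set N : Ω → ℝ := fun ω => (#{ω' | b ω' = b ω} : ℝ)
  have hN : ∀ ω, 0 < N ω := fun ω => by
    have : 0 < #{ω' | b ω' = b ω} := card_pos.2 ⟨ω, by simp⟩
    exact Nat.cast_pos.2 this
  -- The inequality `log z ≤ z - 1` is applied to the ratio of `Q` to the distribution of `b`.
  -- Summed over `ω`, the ratios contribute `|Ω| ∑ Q ≤ |Ω|`, so the corrections total at most zero.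
  have h1 : ∀ ω, E < -log (Q (b ω)) + (Q (b ω) * (Fintype.card Ω / N ω) - 1) := fun ω => by
    have h2 : log (N ω) < log (Fintype.card Ω) - E := by
      have := Real.log_lt_log (hN ω) (hlt ω)
      rwa [Real.log_mul hΩ.ne' (exp_pos _).ne', Real.log_exp, ← sub_eq_add_neg] at this
    have h3 := Real.log_le_sub_one_of_pos (mul_pos (hQ (b ω)) (div_pos hΩ (hN ω)))
    rw [Real.log_mul (hQ _).ne' (div_pos hΩ (hN ω)).ne', Real.log_div hΩ.ne' (hN ω).ne'] at h3
    linarith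
  have h2 : ∑ ω, Q (b ω) * (Fintype.card Ω / N ω) = Fintype.card Ω * ∑ k ∈ univ.image b, Q k := by
    rw [mul_sum, ← sum_fiberwise_of_maps_to (g := b) (t := univ.image b)
      fun ω _ => mem_image_of_mem _ (mem_univ ω)]
    refine sum_congr rfl fun k hk => ?_
    obtain ⟨ω, -, rfl⟩ := mem_image.1 hk
    have : ∀ ω' ∈ univ.filter (fun ω' => b ω' = b ω),
        Q (b ω') * (Fintype.card Ω / N ω') = Q (b ω) * (Fintype.card Ω / N ω) := by
      intro ω' hω'
      simp only [N, (mem_filter.1 hω').2]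
    rw [sum_congr rfl this, sum_const, nsmul_eq_mul]
    have := (hN ω).ne'
    change N ω * _ = _
    field_simp
  have h3 := sum_lt_sum_of_nonempty (univ_nonempty (α := Ω)) fun ω _ => h1 ω
  rw [sum_const, sum_add_distrib, sum_sub_distrib, h2, nsmul_eq_mul] at h3
  simp only [sum_const, nsmul_eq_mul, mul_one, card_univ] at h3
  nlinarith

/-- The value of a linear functional on a coloring. -/
def colorSum {α : Type*} [Fintype α] (χ : α → ℤˣ) (f : α → ℝ) : ℝ := ∑ x, ((χ x : ℤ) : ℝ) * f x

theorem sum_units_int (g : ℤˣ → ℝ) : ∑ u, g u = g 1 + g (-1) := by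
  have : (univ : Finset ℤˣ) = {1, -1} := rfl
  rw [this, sum_pair (by decide)]

variable {α : Type*} [Fintype α] [DecidableEq α]

theorem card_colorings : (Fintype.card (α → ℤˣ) : ℝ) = 2 ^ Fintype.card α := by
  rw [Fintype.card_fun, Fintype.card_units_int]
  norm_cast

/-- The exponential moment factors over the points into hyperbolic cosines, and `cosh z ≤ exp (z ^ 2
/ 2)`. -/
theorem sum_exp_colorSum_le (f : α → ℝ) :
    ∑ χ, exp (colorSum χ f) ≤ 2 ^ Fintype.card α * exp ((∑ x, f x ^ 2) / 2) := by
  have h1 : ∑ χ, exp (colorSum χ f) = ∏ x, (2 * cosh (f x)) := by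
    simp_rw [colorSum, exp_sum]
    have := Finset.prod_univ_sum (fun _ : α => (univ : Finset ℤˣ))
      fun x u => exp (((u : ℤ) : ℝ) * f x)
    rw [Fintype.piFinset_univ] at this
    rw [← this]
    refine prod_congr rfl fun x _ => ?_
    rw [sum_units_int, cosh_eq]
    simp
    ring
  rw [h1, prod_mul_distrib, prod_const, card_univ, sum_div, exp_sum]
  gcongr with x
  exact cosh_le_exp_half_sq _

theorem sum_exp_abs_colorSum_le (f : α → ℝ) :
    ∑ χ, exp |colorSum χ f| ≤ 2 * (2 ^ Fintype.card α * exp ((∑ x, f x ^ 2) / 2)) := by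
  have h1 := sum_exp_colorSum_le f
  have h2 := sum_exp_colorSum_le (-f)
  have h3 : ∀ χ : α → ℤˣ, colorSum χ (-f) = -colorSum χ f := fun χ => by simp [colorSum]
  simp only [h3, Pi.neg_apply, neg_sq] at h2
  have h4 : ∑ χ : α → ℤˣ, exp |colorSum χ f| ≤
      ∑ χ, (exp (colorSum χ f) + exp (-colorSum χ f)) := by
    refine sum_le_sum fun χ _ => ?_
    rcases abs_cases (colorSum χ f) with ⟨h, -⟩ | ⟨h, -⟩ <;> rw [h]
    · linarith [exp_pos (-colorSum χ f)]
    · linarith [exp_pos (colorSum χ f)]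
  rw [sum_add_distrib] at h4
  linarith

/-- The reference distribution on `ℤ` to which the rounded imbalance is compared. -/
noncomputable def refDist (l : ℝ) (k : ℤ) : ℝ :=
  if k = 0 then 1 - exp (-l / 2) / 2 else exp (-l / 2) / 4 * (1 / 2) ^ k.natAbs

theorem refDist_pos {l : ℝ} (hl : 0 < l) (k : ℤ) : 0 < refDist l k := by
  have : exp (-l / 2) < 1 := Real.exp_lt_one_iff.2 (by linarith)
  unfold refDist
  split_ifs
  · linarith
  · positivity

theorem sum_half_pow_natAbs_le (K : Finset ℤ) (h : Set.InjOn Int.natAbs (K : Set ℤ))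
    (h0 : 0 ∉ K) : ∑ k ∈ K, (1 / 2 : ℝ) ^ k.natAbs ≤ 1 := by
  have h1 : ∑ k ∈ K, (1 / 2 : ℝ) ^ k.natAbs = ∑ j ∈ K.image fun k => k.natAbs - 1,
      (1 / 2 : ℝ) ^ (j + 1) := by
    have hpos : ∀ k ∈ K, 1 ≤ k.natAbs := fun k hk =>
      Nat.one_le_iff_ne_zero.2 (Int.natAbs_ne_zero.2 fun h => h0 (h ▸ hk))
    rw [sum_image]
    · exact sum_congr rfl fun k hk => by rw [Nat.sub_add_cancel (hpos k hk)]
    · intro k hk k' hk' he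
      refine h hk hk' ?_
      have := hpos k hk
      have := hpos k' hk'
      simp only at he
      omega
  rw [h1]
  have h2 : HasSum (fun j : ℕ => (1 / 2 : ℝ) ^ (j + 1)) 1 := by
    convert hasSum_geometric_two' (1 : ℝ) using 2 with j
    rw [pow_succ, one_div, inv_pow]
    ring
  exact sum_le_hasSum _ (fun _ _ => by positivity) h2

/-- The positive and the negative integers each carry at most `exp (-l / 2) / 4`, together the mass
removed at `0`. -/
theorem sum_refDist_le {l : ℝ} (hl : 0 < l) (K : Finset ℤ) : ∑ k ∈ K, refDist l k ≤ 1 := by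
  have h1 : ∑ k ∈ insert 0 K, refDist l k ≤ 1 := by
    rw [← insert_erase (mem_insert_self 0 K), sum_insert (notMem_erase _ _)]
    set L := (insert 0 K).erase 0
    have h2 : ∑ k ∈ L, refDist l k = exp (-l / 2) / 4 * ∑ k ∈ L, (1 / 2 : ℝ) ^ k.natAbs := by
      rw [mul_sum]
      exact sum_congr rfl fun k hk => if_neg (ne_of_mem_erase hk)
    have h3 : ∑ k ∈ L, (1 / 2 : ℝ) ^ k.natAbs ≤ 2 := by
      rw [← sum_filter_add_sum_filter_not L (fun k => 0 < k)]
      have hp := sum_half_pow_natAbs_le (L.filter fun k => 0 < k) (fun a ha b hb h => by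
        simp only [coe_filter, Set.mem_ofPred_eq] at ha hb; omega) (by simp)
      have hn := sum_half_pow_natAbs_le (L.filter fun k => ¬ 0 < k) (fun a ha b hb h => by
        simp only [coe_filter, Set.mem_ofPred_eq] at ha hb; omega) (by simp [L])
      linarith
    rw [h2, refDist, if_pos rfl]
    nlinarith [exp_pos (-l / 2)]
  refine le_trans (sum_le_sum_of_subset_of_nonneg (subset_insert 0 K) fun k _ _ =>
    (refDist_pos hl k).le) h1

/-- The bound on the entropy of a rounded imbalance. -/
noncomputable def entropyBound (l : ℝ) : ℝ := 8 * (1 + 1 / l) * exp (-l / 2)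

/-- A zero rounding costs at most `exp (-l / 2)`. A nonzero one forces `l ≤ |u|`; its cost is linear
in `|u|` and is absorbed by `exp (|u| / 2) ≤ exp (-l / 2) * exp |u|`, a form that the moment bound
can average. -/
theorem neg_log_refDist_le {l : ℝ} (hl : 0 < l) (u : ℝ) :
    -log (refDist l (round (u / (2 * l)))) ≤
      exp (-l / 2) + 2 * (1 + 1 / l) * exp (-l / 2) * exp |u| := by
  have he : exp (-l / 2) < 1 := Real.exp_lt_one_iff.2 (by linarith)
  have hep := exp_pos (-l / 2)
  set k := round (u / (2 * l))
  by_cases hk : k = 0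
  · have h1 : -log (refDist l k) ≤ exp (-l / 2) := by
      rw [refDist, if_pos hk]
      have hpos : 0 < 1 - exp (-l / 2) / 2 := by linarith
      rw [← Real.log_inv]
      refine (Real.log_le_sub_one_of_pos (inv_pos.2 hpos)).trans ?_
      rw [sub_le_iff_le_add, inv_le_iff_one_le_mul₀ hpos]
      nlinarith
    have : 0 < 2 * (1 + 1 / l) * exp (-l / 2) * exp |u| := by positivity
    linarith
  · have hk1 : (1 : ℝ) ≤ k.natAbs := by
      exact_mod_cast Nat.one_le_iff_ne_zero.2 (Int.natAbs_ne_zero.2 hk)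
    have hkabs : ((k.natAbs : ℕ) : ℝ) = |(k : ℝ)| := by
      rw [← Int.cast_abs, Int.abs_eq_natAbs]; rfl
    have hround : |(k : ℝ)| ≤ |u| / (2 * l) + 1 / 2 := by
      have h1 := abs_sub_round (u / (2 * l))
      have h2 := abs_sub_abs_le_abs_sub (k : ℝ) (u / (2 * l))
      rw [abs_sub_comm, abs_div, abs_of_pos (show 0 < 2 * l by linarith)] at h2
      linarith
    have hul : l ≤ |u| := by
      have h3 : 1 / 2 ≤ |u| / (2 * l) := by linarith
      rw [le_div_iff₀ (by linarith)] at h3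
      linarith
    have hkl : |(k : ℝ)| ≤ |u| / l := by
      have h4 : |u| / (2 * l) = |u| / l / 2 := by field_simp
      have h5 : 1 ≤ |u| / l := (one_le_div hl).2 hul
      linarith
    have hlog : -log (refDist l k) = 2 * log 2 + l / 2 + |(k : ℝ)| * log 2 := by
      rw [refDist, if_neg hk, Real.log_mul (by positivity) (by positivity),
        Real.log_div hep.ne' (by norm_num), Real.log_exp, Real.log_pow, hkabs, one_div,
        Real.log_inv, show (4 : ℝ) = 2 ^ 2 by norm_num, Real.log_pow]
      push_cast
      ring
    have hlog2 : log 2 < 1 := by linarith [Real.log_two_lt_d9]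
    have hlog2p : 0 < log 2 := Real.log_pos (by norm_num)
    have h6 : -log (refDist l k) ≤ (1 + 1 / l) * (2 + |u|) := by
      rw [hlog]
      have h7 : |(k : ℝ)| * log 2 ≤ |u| / l := by
        have := abs_nonneg (k : ℝ)
        nlinarith
      have h8 : (1 + 1 / l) * (2 + |u|) = 2 + |u| + 2 / l + |u| / l := by field_simp; ring
      have : 0 < 2 / l := by positivity
      rw [h8]
      linarith
    have h9 : 2 + |u| ≤ 2 * exp (|u| / 2) := by
      have := add_one_le_exp (|u| / 2)
      linarith
    have h10 : exp (|u| / 2) ≤ exp (-l / 2) * exp |u| := by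
      rw [← exp_add]
      exact exp_le_exp.2 (by linarith)
    have h11 : 0 < 1 + 1 / l := by positivity
    have h12 : (1 + 1 / l) * (2 + |u|) ≤ (1 + 1 / l) * (2 * (exp (-l / 2) * exp |u|)) :=
      mul_le_mul_of_nonneg_left (by linarith) h11.le
    linarith

theorem sum_neg_log_refDist_le {l σ : ℝ} (hl : 0 < l) (hσ : 0 < σ) (f : α → ℝ)
    (hf : ∑ x, f x ^ 2 ≤ σ ^ 2) :
    ∑ χ, -log (refDist l (round (colorSum χ f / (2 * (l * σ))))) ≤
      2 ^ Fintype.card α * entropyBound l := by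
  set g : α → ℝ := fun x => f x / σ
  have hg : ∀ χ : α → ℤˣ, colorSum χ f / (2 * (l * σ)) = colorSum χ g / (2 * l) := fun χ => by
    have : colorSum χ g = colorSum χ f / σ := by
      simp only [colorSum, g, sum_div]
      exact sum_congr rfl fun x _ => by ring
    rw [this]
    field_simp
  have hg2 : ∑ x, g x ^ 2 ≤ 1 := by
    simp only [g, div_pow, ← sum_div]
    exact (div_le_one (by positivity)).2 hf
  have h1 := sum_exp_abs_colorSum_le g
  -- The average of `exp |colorSum χ g|` is then at most `7 / 2`, and `1 + 7 (1 + 1 / l) ≤ 8 (1 + 1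
  -- / l)` explains the constant in `entropyBound`.
  have h2 : exp ((∑ x, g x ^ 2) / 2) ≤ 7 / 4 := by
    have h3 : exp ((∑ x, g x ^ 2) / 2) ≤ exp (1 / 2) := exp_le_exp.2 (by linarith)
    have h4 : exp (1 / 2) ^ 2 ≤ (7 / 4) ^ 2 := by
      rw [← exp_nat_mul]
      norm_num
      linarith [exp_one_lt_d9]
    exact h3.trans (le_of_sq_le_sq h4 (by norm_num))
  simp only [hg]
  refine (sum_le_sum fun χ _ => neg_log_refDist_le hl (colorSum χ g)).trans ?_
  rw [sum_add_distrib, ← mul_sum, sum_const, nsmul_eq_mul, card_univ, card_colorings]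
  have hP : (0 : ℝ) < 2 ^ Fintype.card α := by positivity
  have h5 : ∑ χ : α → ℤˣ, exp |colorSum χ g| ≤ 7 / 2 * 2 ^ Fintype.card α := by nlinarith
  have hc : 0 < 2 * (1 + 1 / l) * exp (-l / 2) := by positivity
  have h6 := mul_le_mul_of_nonneg_left h5 hc.le
  have h7 : 0 < 1 / l := by positivity
  unfold entropyBound
  have h8 : 0 < exp (-l / 2) * 2 ^ Fintype.card α := by positivity
  nlinarith

/-- Chernoff bound for a Hamming ball of radius `n / 10`: with weight `1 / 9` per disagreement, all
colorings weigh `(10 / 9) ^ n` together and each one in the ball at least `(1 / 9) ^ (n / 10)`.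
Tenth powers avoid fractional exponents. -/
theorem card_near_coloring_le (χ₀ : α → ℤˣ) :
    (#{χ : α → ℤˣ | 10 * #{x | χ x ≠ χ₀ x} ≤ Fintype.card α} : ℝ) ^ 10 ≤
      ((10 / 9) ^ 10 * 9) ^ Fintype.card α := by
  set n := Fintype.card α
  set y : ℝ := (1 / 9) ^ (1 / 10 : ℝ)
  have hy0 : 0 < y := by positivity
  have hy10 : y ^ 10 = 1 / 9 := by
    rw [← rpow_natCast, ← rpow_mul (by norm_num)]
    norm_num
  have hy1 : y ≤ 1 := rpow_le_one (by norm_num) (by norm_num) (by norm_num)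
  have h1 : ∑ χ : α → ℤˣ, (1 / 9 : ℝ) ^ #{x | χ x ≠ χ₀ x} = (10 / 9) ^ n := by
    have := Finset.prod_univ_sum (fun _ : α => (univ : Finset ℤˣ))
      fun x u => if u ≠ χ₀ x then (1 / 9 : ℝ) else 1
    rw [Fintype.piFinset_univ] at this
    have h2 : ∀ x, ∑ u : ℤˣ, (if u ≠ χ₀ x then (1 / 9 : ℝ) else 1) = 10 / 9 := fun x => by
      rw [sum_units_int]
      rcases Int.units_eq_one_or (χ₀ x) with h | h <;> rw [h]
      · rw [if_neg (by simp), if_pos (by decide)]; norm_num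
      · rw [if_pos (by decide), if_neg (by simp)]; norm_num
    rw [prod_congr rfl fun x _ => h2 x, prod_const, card_univ] at this
    rw [this]
    refine sum_congr rfl fun χ _ => ?_
    rw [prod_ite, prod_const, prod_const_one, mul_one]
  set A := ({χ : α → ℤˣ | 10 * #{x | χ x ≠ χ₀ x} ≤ n} : Finset (α → ℤˣ))
  have h3 : (#A : ℝ) * y ^ n ≤ (10 / 9) ^ n := by
    rw [← h1, ← nsmul_eq_mul, ← sum_const]
    refine (sum_le_sum fun χ hχ => ?_).trans
      (sum_le_sum_of_subset_of_nonneg (subset_univ A) fun _ _ _ => by positivity)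
    rw [← hy10, ← pow_mul]
    exact pow_le_pow_of_le_one hy0.le hy1 (mem_filter.1 hχ).2
  have h4 := pow_le_pow_left₀ (by positivity) h3 10
  rw [mul_pow, ← pow_mul, mul_comm n 10, pow_mul, hy10, ← pow_mul, mul_comm n 10, pow_mul] at h4
  rw [mul_pow, one_div, inv_pow, ← div_eq_mul_inv, div_le_iff₀ (by positivity)] at *
  exact h4

/-- The partial coloring lemma. -/
theorem exists_partial_coloring [Nonempty α] {J : Type*} [Fintype J] (f : J → α → ℝ)
    (σ l : J → ℝ) (hσ : ∀ j, 0 < σ j) (hl : ∀ j, 0 < l j) (hf : ∀ j, ∑ x, f j x ^ 2 ≤ σ j ^ 2)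
    (hE : ∑ j, entropyBound (l j) ≤ Fintype.card α / 5) :
    ∃ ψ : α → ℤ, (∀ x, ψ x = 0 ∨ ψ x = 1 ∨ ψ x = -1) ∧ Fintype.card α ≤ 10 * #{x | ψ x ≠ 0} ∧
      ∀ j, |∑ x, (ψ x : ℝ) * f j x| ≤ l j * σ j := by
  classical
  set n := Fintype.card α
  have hn : 0 < n := Fintype.card_pos
  set b : (α → ℤˣ) → J → ℤ := fun χ j => round (colorSum χ (f j) / (2 * (l j * σ j)))
  set Q : (J → ℤ) → ℝ := fun k => ∏ j, refDist (l j) (k j)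
  have hQ : ∀ k, 0 < Q k := fun k => prod_pos fun j _ => refDist_pos (hl j) _
  have hsum : ∑ k ∈ univ.image b, Q k ≤ 1 := by
    have hsub : univ.image b ⊆ Fintype.piFinset fun j => univ.image fun χ => b χ j := by
      intro k hk
      obtain ⟨χ, -, rfl⟩ := mem_image.1 hk
      exact Fintype.mem_piFinset.2 fun j => mem_image_of_mem (fun χ => b χ j) (mem_univ χ)
    refine (sum_le_sum_of_subset_of_nonneg hsub fun k _ _ => (hQ k).le).trans ?_
    rw [← Finset.prod_univ_sum]
    exact prod_le_one (fun j _ => sum_nonneg fun k _ => (refDist_pos (hl j) k).le)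
      fun j _ => sum_refDist_le (hl j) _
  have hE' : ∑ χ, -log (Q (b χ)) ≤ Fintype.card (α → ℤˣ) * (n / 5 : ℝ) := by
    have h1 : ∀ χ, -log (Q (b χ)) = ∑ j, -log (refDist (l j) (b χ j)) := fun χ => by
      rw [Real.log_prod fun j _ => (refDist_pos (hl j) _).ne', sum_neg_distrib]
    simp only [h1]
    rw [sum_comm, card_colorings]
    refine (sum_le_sum fun j _ => sum_neg_log_refDist_le (hl j) (hσ j) (f j) (hf j)).trans ?_
    rw [← mul_sum]
    exact mul_le_mul_of_nonneg_left hE (by positivity)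
  obtain ⟨χ₀, hχ₀⟩ := exists_large_fiber b Q hQ hsum hE'
  -- The fibre of `χ₀` has at least `2 ^ n * exp (-n / 5)` elements and does not fit in a Hamming
  -- ball of radius `n / 10`, because `(10 / 9) ^ 10 * 9 < 2 ^ 10 * exp (-2)`.
  obtain ⟨χ, hχb, hχ⟩ : ∃ χ, b χ = b χ₀ ∧ n < 10 * #{x | χ x ≠ χ₀ x} := by
    by_contra! hall
    have h1 : #{χ | b χ = b χ₀} ≤ #{χ : α → ℤˣ | 10 * #{x | χ x ≠ χ₀ x} ≤ n} :=
      card_le_card fun χ h => mem_filter.2 ⟨mem_univ _, hall χ (mem_filter.1 h).2⟩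
    have h2 : (2 ^ n * exp (-(n / 5 : ℝ))) ^ 10 ≤ ((10 / 9) ^ 10 * 9) ^ n := by
      refine le_trans (pow_le_pow_left₀ (by positivity) ?_ 10) (card_near_coloring_le χ₀)
      rw [← card_colorings]
      exact hχ₀.trans (by exact_mod_cast h1)
    have h3 : (2 ^ n * exp (-(n / 5 : ℝ))) ^ 10 = (2 ^ 10 * exp (-2)) ^ n := by
      rw [mul_pow, mul_pow, ← exp_nat_mul, ← exp_nat_mul, ← pow_mul, ← pow_mul, mul_comm n 10]
      congr 2
      push_cast
      ring
    rw [h3] at h2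
    refine absurd h2 (not_le.2 (pow_lt_pow_left₀ ?_ (by positivity) hn.ne'))
    have h4 : exp 2 < 8 := by
      have := exp_one_lt_d9
      have h5 : exp 2 = exp 1 * exp 1 := by rw [← exp_add]; norm_num
      nlinarith [exp_pos 1]
    rw [exp_neg, ← div_eq_mul_inv, lt_div_iff₀ (exp_pos 2)]
    norm_num
    linarith
  -- This is `(χ - χ₀) / 2`. Equal roundings in units of `2 l σ` bound the difference of the two
  -- imbalances by `2 l σ`.
  refine ⟨fun x => if χ x = χ₀ x then 0 else (χ x : ℤ), fun x => ?_, ?_, fun j => ?_⟩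
  · by_cases h' : χ x = χ₀ x
    · exact Or.inl (if_pos h')
    · rcases Int.units_eq_one_or (χ x) with h | h
      · exact Or.inr (Or.inl ((if_neg h').trans (by rw [h]; rfl)))
      · exact Or.inr (Or.inr ((if_neg h').trans (by rw [h]; rfl)))
  · refine hχ.le.trans_eq ?_
    congr 2
    ext x
    by_cases h : χ x = χ₀ x <;> simp [h]
  · have h1 : ∑ x, (((if χ x = χ₀ x then 0 else (χ x : ℤ)) : ℤ) : ℝ) * f j x =
        (colorSum χ (f j) - colorSum χ₀ (f j)) / 2 := by
      rw [colorSum, colorSum, ← sum_sub_distrib, sum_div]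
      refine sum_congr rfl fun x _ => ?_
      rcases Int.units_eq_one_or (χ x) with h | h <;>
        rcases Int.units_eq_one_or (χ₀ x) with h' | h' <;> rw [h, h']
      · simp
      · rw [if_neg (by decide)]; push_cast; ring
      · rw [if_neg (by decide)]; push_cast; ring
      · simp
    have hpos : 0 < 2 * (l j * σ j) := mul_pos two_pos (mul_pos (hl j) (hσ j))
    have h2 := abs_sub_round (colorSum χ (f j) / (2 * (l j * σ j)))
    have h3 := abs_sub_round (colorSum χ₀ (f j) / (2 * (l j * σ j)))
    have h4 : round (colorSum χ (f j) / (2 * (l j * σ j))) =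
      round (colorSum χ₀ (f j) / (2 * (l j * σ j))) := congrFun hχb j
    rw [h4] at h2
    have h5 : |colorSum χ (f j) / (2 * (l j * σ j)) - colorSum χ₀ (f j) / (2 * (l j * σ j))| ≤ 1 := by
      rw [abs_le] at *
      constructor <;> linarith
    rw [← sub_div, abs_div, abs_of_pos hpos, div_le_one hpos] at h5
    rw [h1, abs_div, abs_two]
    linarith

end Entropy

end KineticDiscrepancy

namespace KineticDiscrepancy

open Finset Real

/-! ### From the shatter function to the discrepancy -/

section Chaining

/-- Each term is at most six times the increment of `z / (1 + z)` from `z` to `2 z`; the increments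
telescope to less than one. -/
theorem sum_min_inv_le {y : ℝ} (hy : 0 < y) (k : ℕ) :
    ∑ i ∈ Finset.range k, min (2 ^ i * y) (1 / (2 ^ i * y)) ≤ 6 := by
  have key : ∀ z : ℝ, 0 < z → min z (1 / z) ≤ 6 * (2 * z / (1 + 2 * z) - z / (1 + z)) := by
    intro z hz
    have h1 : 2 * z / (1 + 2 * z) - z / (1 + z) = z / ((1 + 2 * z) * (1 + z)) := by
      field_simp
      ring
    rw [h1, ← mul_div_assoc, le_div_iff₀ (by positivity)]
    rcases le_total z 1 with h | h
    · have := min_le_left z (1 / z)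
      have h2 : (1 + 2 * z) * (1 + z) ≤ 6 := by nlinarith
      calc min z (1 / z) * ((1 + 2 * z) * (1 + z)) ≤ z * 6 := by gcongr
        _ = 6 * z := by ring
    · have := min_le_right z (1 / z)
      have h2 : (1 + 2 * z) * (1 + z) ≤ 6 * z ^ 2 := by nlinarith
      calc min z (1 / z) * ((1 + 2 * z) * (1 + z)) ≤ 1 / z * (6 * z ^ 2) := by gcongr
        _ = 6 * z := by field_simp
  have h : ∑ i ∈ Finset.range k, min (2 ^ i * y) (1 / (2 ^ i * y)) ≤
      6 * (2 ^ k * y / (1 + 2 ^ k * y) - y / (1 + y)) := by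
    induction k with
    | zero => simp
    | succ k ih =>
      rw [sum_range_succ]
      have := key (2 ^ k * y) (by positivity)
      rw [pow_succ]
      rw [show (2 : ℝ) ^ k * 2 * y = 2 * (2 ^ k * y) by ring]
      linarith
  have h1 : 2 ^ k * y / (1 + 2 ^ k * y) ≤ 1 := (div_le_one (by positivity)).2 (by linarith)
  have h2 : 0 < y / (1 + y) := by positivity
  linarith

/-- Up to constants, the left side is the entropy spent on one level of the chain. For `y ≤ 1` the
power of `y` outweighs the factor `1 / y ^ 3`; for `y ≥ 1` the exponential decay beats the power. -/
theorem pow_mul_entropyBound_le {D : ℕ} (hD : 1 ≤ D) {y : ℝ} (hy : 0 < y) :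
    y ^ (4 * D) * entropyBound (min (y ^ 3) y) ≤
      16 * (2 ^ (4 * D + 1) * (4 * D + 1).factorial) * min y (1 / y) := by
  have hM : (1 : ℝ) ≤ 2 ^ (4 * D + 1) * (4 * D + 1).factorial := by
    exact_mod_cast Nat.one_le_iff_ne_zero.2 (by positivity)
  unfold entropyBound
  rcases le_total y 1 with h | h
  · have h3 : y ^ 3 ≤ y := by
      calc y ^ 3 ≤ y ^ 1 := pow_le_pow_of_le_one hy.le h (by norm_num)
        _ = y := pow_one y
    rw [min_eq_left h3, min_eq_left (h.trans ((one_le_div hy).2 h))]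
    have hexp : exp (-y ^ 3 / 2) ≤ 1 := exp_le_one_iff.2 (by have := pow_pos hy 3; linarith)
    obtain ⟨e, rfl⟩ : ∃ e, D = e + 1 := ⟨D - 1, by omega⟩
    have h4 : y ^ (4 * (e + 1)) * (1 + 1 / y ^ 3) = y ^ (4 * e + 1) * (y ^ 3 + 1) := by
      field_simp
      ring
    have h5 : y ^ (4 * e + 1) ≤ y := by
      calc y ^ (4 * e + 1) ≤ y ^ 1 := pow_le_pow_of_le_one hy.le h (by omega)
        _ = y := pow_one y
    have h6 : y ^ 3 + 1 ≤ 2 := by linarith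
    calc y ^ (4 * (e + 1)) * (8 * (1 + 1 / y ^ 3) * exp (-y ^ 3 / 2))
        = 8 * (y ^ (4 * (e + 1)) * (1 + 1 / y ^ 3)) * exp (-y ^ 3 / 2) := by ring
      _ = 8 * (y ^ (4 * e + 1) * (y ^ 3 + 1)) * exp (-y ^ 3 / 2) := by rw [h4]
      _ ≤ 8 * (y * 2) * 1 := by gcongr
      _ = 16 * 1 * y := by ring
      _ ≤ _ := by gcongr
  · have h3 : y ≤ y ^ 3 := by
      calc y = y ^ 1 := (pow_one y).symm
        _ ≤ y ^ 3 := pow_le_pow_right₀ h (by norm_num)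
    rw [min_eq_right h3, min_eq_right (((div_le_one hy).2 h).trans h)]
    have h4 := pow_div_factorial_le_exp (y / 2) (show 0 ≤ y / 2 by positivity) (4 * D + 1)
    rw [div_le_iff₀ (by positivity), div_pow, div_le_iff₀ (by positivity), pow_succ] at h4
    have h5 : y ^ (4 * D) * exp (-y / 2) ≤ 2 ^ (4 * D + 1) * (4 * D + 1).factorial * (1 / y) := by
      rw [neg_div, exp_neg, ← div_eq_mul_inv, mul_one_div, div_le_div_iff₀ (exp_pos _) hy]
      linarith
    have h6 : 1 / y ≤ 1 := (div_le_one hy).2 h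
    have h7 : 0 < y ^ (4 * D) * exp (-y / 2) := by positivity
    calc y ^ (4 * D) * (8 * (1 + 1 / y) * exp (-y / 2))
        = 8 * (1 + 1 / y) * (y ^ (4 * D) * exp (-y / 2)) := by ring
      _ ≤ 8 * (1 + 1) * (y ^ (4 * D) * exp (-y / 2)) := by gcongr
      _ ≤ 8 * (1 + 1) * (2 ^ (4 * D + 1) * (4 * D + 1).factorial * (1 / y)) := by gcongr
      _ = _ := by ring

theorem sum_sq_sub_indicator {α : Type*} [Fintype α] [DecidableEq α] (S T : Finset α) :
    ∑ x, ((if x ∈ S then (1 : ℝ) else 0) - if x ∈ T then (1 : ℝ) else 0) ^ 2 = (#(symmDiff S T) : ℝ) := by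
  have : ∀ x, ((if x ∈ S then (1 : ℝ) else 0) - if x ∈ T then (1 : ℝ) else 0) ^ 2 =
      if x ∈ symmDiff S T then 1 else 0 := fun x => by
    by_cases h : x ∈ S <;> by_cases h' : x ∈ T <;> simp [h, h', mem_symmDiff]
  simp only [this]
  rw [sum_boole, filter_mem_eq_inter, univ_inter]

/-- Chaining: the differences between consecutive nets are fed to the partial coloring lemma. The
critical level has `2 ^ i ≈ ρ`, with about `n` net members; entropy and imbalance both decay
geometrically away from it. -/
theorem exists_partial_coloring_of_shatterBound (c D : ℕ) (hD : 1 ≤ D) : ∃ C : ℝ, 0 < C ∧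
    ∀ {α : Type*} [Fintype α] [DecidableEq α] [Nonempty α] (F : Finset (Finset α)),
      ShatterBound F c D → ∃ ψ : α → ℤ, (∀ x, ψ x = 0 ∨ ψ x = 1 ∨ ψ x = -1) ∧
        Fintype.card α ≤ 10 * #{x | ψ x ≠ 0} ∧
        ∀ S ∈ F, |∑ x ∈ S, (ψ x : ℝ)| ≤
          C * (Fintype.card α : ℝ) ^ ((1 : ℝ) / 2 - 1 / (2 * D)) := by
  obtain ⟨K, hK, hnet⟩ := exists_net_const c D
  set M : ℝ := 16 * (2 ^ (4 * D + 1) * (4 * D + 1).factorial)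
  have hM : 0 < M := by positivity
  -- Chosen so that the total entropy `6 K κ n M` equals the budget `n / 5`.
  set κ : ℝ := 1 / (30 * K * M)
  have hκ : 0 < κ := by positivity
  refine ⟨24 / κ ^ (1 / (2 * D) : ℝ), by positivity, ?_⟩
  intro α _ _ _ F hF
  set n := Fintype.card α
  have hn : 0 < n := Fintype.card_pos
  have hnR : (0 : ℝ) < n := by exact_mod_cast hn
  have hDR : (0 : ℝ) < D := by exact_mod_cast hD
  have hnets : ∀ i : ℕ, ∃ G ⊆ F, (#G : ℝ) ≤ K * (16 ^ i) ^ D ∧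
      ∀ S ∈ F, ∃ T ∈ G, (#(symmDiff S T) : ℝ) < n / 16 ^ i := fun i => by
    obtain ⟨G, hGF, hG, hG'⟩ := hnet F hF (n / 16 ^ i) (by positivity)
      (div_le_self hnR.le (one_le_pow₀ (by norm_num)))
    refine ⟨G, hGF, ?_, hG'⟩
    rwa [div_div_cancel₀ hnR.ne'] at hG
  choose G hGF hGcard hG using hnets
  choose! pr hprG hpr using hG
  -- Chains start from the empty set, within distance `n` of every set of level `0`.
  set prev : ℕ → Finset α → Finset α := fun i S => Nat.casesOn i ∅ fun j => pr j S
  set ρ : ℝ := (κ * n) ^ (1 / (4 * D) : ℝ)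
  have hρ : 0 < ρ := by positivity
  have hρD : ρ ^ (4 * D) = κ * n := by
    rw [← rpow_natCast, ← rpow_mul (by positivity)]
    push_cast
    rw [one_div_mul_cancel (by positivity), rpow_one]
  have hρ2 : ρ ^ 2 = κ ^ (1 / (2 * D) : ℝ) * (n : ℝ) ^ (1 / (2 * D) : ℝ) := by
    rw [← mul_rpow hκ.le hnR.le, ← rpow_natCast, ← rpow_mul (by positivity)]
    congr 1
    push_cast
    field_simp
    norm_num
  set y : ℕ → ℝ := fun i => 2 ^ i * (1 / ρ)
  have hy : ∀ i, 0 < y i := fun i => by positivity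
  set l : ℕ → ℝ := fun i => min (y i ^ 3) (y i)
  have hl : ∀ i, 0 < l i := fun i => lt_min (pow_pos (hy i) 3) (hy i)
  -- Here `σ i ^ 2 = 16 n / 16 ^ i`, the net distance of level `i - 1`, since a link joins level `i`
  -- to the level before.
  set σ : ℕ → ℝ := fun i => 4 * √n / 4 ^ i
  have hσ : ∀ i, 0 < σ i := fun i => by positivity
  have hlσ : ∀ i, l i * σ i = 4 * √n / ρ ^ 2 * min (y i) (1 / y i) := fun i => by
    have h4 : (4 : ℝ) ^ i = ρ ^ 2 * y i ^ 2 := by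
      simp only [y]
      rw [mul_pow, ← pow_mul, mul_comm i 2, pow_mul]
      field_simp
      norm_num
    have hm : l i = y i ^ 2 * min (y i) (1 / y i) := by
      rw [mul_min_of_nonneg _ _ (by positivity)]
      simp only [l]
      congr 1
      have := (hy i).ne'
      field_simp
    have := (hy i).ne'
    simp only [σ]
    rw [hm, h4]
    field_simp
  obtain ⟨ψ, hψ, hcard, hdisc⟩ := exists_partial_coloring
    (J := (i : Fin (n + 1)) × {S // S ∈ G i})
    (fun j x => (if x ∈ j.2.1 then (1 : ℝ) else 0) - if x ∈ prev j.1 j.2.1 then 1 else 0)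
    (fun j => σ j.1) (fun j => l j.1) (fun j => hσ _) (fun j => hl _) (by
      rintro ⟨⟨i, hi⟩, S, hS⟩
      rw [sum_sq_sub_indicator]
      simp only [σ]
      rw [div_pow, mul_pow, sq_sqrt hnR.le, ← pow_mul, mul_comm i 2, pow_mul]
      norm_num
      cases i with
      | zero =>
        have : #(symmDiff S ∅) ≤ n := card_le_univ _
        have h2 : (#(symmDiff S ∅) : ℝ) ≤ n := by exact_mod_cast this
        simp only [pow_zero, div_one]
        change (#(symmDiff S ∅) : ℝ) ≤ _
        linarith
      | succ i =>
        refine (hpr i S (hGF _ hS)).le.trans_eq ?_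
        rw [pow_succ]
        field_simp) (by
      rw [Fintype.sum_sigma]
      have h1 : ∀ i : Fin (n + 1), ∑ _S : {S // S ∈ G i}, entropyBound (l i) ≤
          K * (κ * n) * M * min (y i) (1 / y i) := fun i => by
        rw [sum_const, card_univ, Fintype.card_coe, nsmul_eq_mul]
        have h16 : ((16 : ℝ) ^ (i : ℕ)) ^ D = κ * n * y i ^ (4 * D) := by
          rw [← hρD, ← mul_pow]
          simp only [y]
          rw [show ρ * (2 ^ (i : ℕ) * (1 / ρ)) = 2 ^ (i : ℕ) by field_simp, pow_mul]
          congr 1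
          rw [← pow_mul, mul_comm, pow_mul]
          norm_num
        have hE0 : 0 < entropyBound (l i) := by
          have := hl i
          unfold entropyBound
          positivity
        calc (#(G i) : ℝ) * entropyBound (l i) ≤ K * (16 ^ (i : ℕ)) ^ D * entropyBound (l i) := by
              gcongr
              exact hGcard i
          _ = K * (κ * n) * (y i ^ (4 * D) * entropyBound (l i)) := by rw [h16]; ring
          _ ≤ K * (κ * n) * (M * min (y i) (1 / y i)) := by
              exact mul_le_mul_of_nonneg_left (pow_mul_entropyBound_le hD (hy i)) (by positivity)
          _ = _ := by ring
      refine (sum_le_sum fun i _ => h1 i).trans ?_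
      rw [← mul_sum, Fin.sum_univ_eq_sum_range fun i => min (y i) (1 / y i)]
      have h2 := sum_min_inv_le (one_div_pos.2 hρ) (n + 1)
      calc K * (κ * n) * M * ∑ i ∈ Finset.range (n + 1), min (y i) (1 / y i)
          ≤ K * (κ * n) * M * 6 := by gcongr
        _ = n / 5 := by simp only [κ]; field_simp; norm_num)
  refine ⟨ψ, hψ, hcard, ?_⟩
  have hchain : ∀ i, i < n + 1 → ∀ S ∈ G i, |∑ x ∈ S, (ψ x : ℝ)| ≤
      ∑ j ∈ Finset.range (i + 1), l j * σ j := by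
    have hdiff : ∀ i, i < n + 1 → ∀ S ∈ G i,
        |∑ x ∈ S, (ψ x : ℝ) - ∑ x ∈ prev i S, (ψ x : ℝ)| ≤ l i * σ i := by
      intro i hi S hS
      have := hdisc ⟨⟨i, hi⟩, S, hS⟩
      simpa [mul_sub, sum_sub_distrib] using this
    intro i
    induction i with
    | zero =>
      intro hi S hS
      have := hdiff 0 hi S hS
      simpa [prev] using this
    | succ i ih =>
      intro hi S hS
      have h1 := hdiff (i + 1) hi S hS
      have h2 := ih (by omega) (pr i S) (hprG i S (hGF _ hS))
      rw [sum_range_succ]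
      have h3 := abs_add_le (∑ x ∈ S, (ψ x : ℝ) - ∑ x ∈ pr i S, (ψ x : ℝ)) (∑ x ∈ pr i S, (ψ x : ℝ))
      rw [sub_add_cancel] at h3
      change |∑ x ∈ S, (ψ x : ℝ) - ∑ x ∈ pr i S, (ψ x : ℝ)| ≤ _ at h1
      linarith
  intro S hS
  -- At level `n` the net distance is at most one, so a set coincides with its approximation and the
  -- chain reaches it exactly.
  have hSG : S ∈ G n := by
    have h1 := hpr n S hS
    have h2 : (n : ℝ) / 16 ^ n ≤ 1 := by
      rw [div_le_one (by positivity)]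
      exact_mod_cast (Nat.lt_pow_self (by norm_num : 1 < 16)).le
    have h3 : #(symmDiff S (pr n S)) < 1 := by exact_mod_cast h1.trans_le h2
    have h4 : symmDiff S (pr n S) = ∅ := card_eq_zero.1 (by omega)
    have h5 : S = pr n S := symmDiff_eq_bot.1 h4
    rw [h5]
    exact hprG n S hS
  refine (hchain n (by omega) S hSG).trans ?_
  simp only [hlσ]
  rw [← mul_sum]
  calc 4 * √n / ρ ^ 2 * ∑ i ∈ Finset.range (n + 1), min (y i) (1 / y i)
      ≤ 4 * √n / ρ ^ 2 * 6 := by gcongr; exact sum_min_inv_le (one_div_pos.2 hρ) (n + 1)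
    _ = _ := by
      rw [hρ2, rpow_sub hnR, sqrt_eq_rpow]
      field_simp
      norm_num

end Chaining

end KineticDiscrepancy

namespace KineticDiscrepancy

open Finset Real

/-! ### Full colorings by iterated partial coloring -/

section Iteration

theorem ShatterBound.subtype {α : Type*} [DecidableEq α] {F : Finset (Finset α)} {c D : ℕ}
    (h : ShatterBound F c D) (Y : Finset α) :
    ShatterBound (F.image fun S => S.subtype (· ∈ Y)) c D := fun m a => by
  rw [image_image]
  convert h m (fun i => (a i : α)) using 3
  ext S i
  simp

/-- A family with shatter function `O(m ^ D)` has discrepancy `O(n ^ (1 / 2 - 1 / (2 D)))`. -/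
theorem exists_coloring_of_shatterBound (c D : ℕ) (hD : 2 ≤ D) : ∃ C : ℝ, 0 < C ∧
    ∀ {α : Type*} [DecidableEq α] (F : Finset (Finset α)), ShatterBound F c D →
      ∀ Y : Finset α, ∃ χ : α → ℤˣ, ∀ S ∈ F, |∑ x ∈ Y with x ∈ S, ((χ x : ℤ) : ℝ)| ≤
        C * (#Y : ℝ) ^ ((1 : ℝ) / 2 - 1 / (2 * D)) := by
  obtain ⟨C₁, hC₁, hpart⟩ := exists_partial_coloring_of_shatterBound c D (by omega)
  set e : ℝ := (1 : ℝ) / 2 - 1 / (2 * D)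
  -- Positivity of the exponent needs `2 ≤ D`; it makes `r < 1`, so that the rounds sum
  -- geometrically to `C₁ / (1 - r)`.
  have he : 0 < e := by
    have h2 : (2 : ℝ) ≤ D := by exact_mod_cast hD
    have : (1 : ℝ) / (2 * D) ≤ 1 / 4 := one_div_le_one_div_of_le (by norm_num) (by linarith)
    simp only [e]
    linarith
  set r : ℝ := (9 / 10) ^ e
  have hr : r < 1 := rpow_lt_one (by norm_num) (by norm_num) he
  have hr1 : 0 < 1 - r := by linarith
  refine ⟨C₁ / (1 - r), by positivity, ?_⟩
  intro α _ F hF Y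
  induction hk : #Y using Nat.strong_induction_on generalizing Y with
  | _ k ih =>
  subst hk
  rcases Y.eq_empty_or_nonempty with rfl | hne
  · refine ⟨fun _ => 1, fun S _ => ?_⟩
    simp only [filter_empty, sum_empty, abs_zero]
    positivity
  have : Nonempty Y := hne.to_subtype
  obtain ⟨ψ, hψ, hcard, hdisc⟩ := hpart _ (hF.subtype Y)
  rw [Fintype.card_coe] at hcard
  simp only [Fintype.card_coe] at hdisc
  set φ : α → ℤ := fun x => if h : x ∈ Y then ψ ⟨x, h⟩ else 0
  have hφ : ∀ x (h : x ∈ Y), φ x = ψ ⟨x, h⟩ := fun x h => dif_pos h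
  set Y' := Y.filter fun x => φ x = 0
  have hY' : 10 * #Y' ≤ 9 * #Y := by
    have h1 := card_filter_add_card_filter_not (s := Y) fun x => φ x = 0
    have h2 : #{x | ψ x ≠ 0} = #(Y.filter fun x => ¬φ x = 0) := by
      rw [← card_map (Function.Embedding.subtype (· ∈ Y))]
      congr 1
      ext x
      simp only [mem_map, mem_filter, mem_univ, true_and, Function.Embedding.subtype_apply]
      constructor
      · rintro ⟨⟨z, hz⟩, hne, rfl⟩
        exact ⟨hz, by rwa [hφ z hz]⟩
      · rintro ⟨hx, hne⟩
        exact ⟨⟨x, hx⟩, by rwa [hφ x hx] at hne, rfl⟩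
    have h3 : #Y' = #(Y.filter fun x => φ x = 0) := rfl
    omega
  have hYpos : 0 < #Y := hne.card_pos
  obtain ⟨χ', hχ'⟩ := ih #Y' (by omega) Y' rfl
  refine ⟨fun x => if φ x = 1 then 1 else if φ x = -1 then -1 else χ' x, fun S hS => ?_⟩
  have hsplit : ∑ x ∈ Y with x ∈ S,
      (((if φ x = 1 then 1 else if φ x = -1 then -1 else χ' x : ℤˣ) : ℤ) : ℝ) =
      ∑ x ∈ S.subtype (· ∈ Y), (ψ x : ℝ) + ∑ x ∈ Y' with x ∈ S, ((χ' x : ℤ) : ℝ) := by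
    have h1 : ∑ x ∈ S.subtype (· ∈ Y), (ψ x : ℝ) = ∑ x ∈ Y with x ∈ S, (φ x : ℝ) := by
      have h2 : Y.filter (· ∈ S) = (S.subtype (· ∈ Y)).map (Function.Embedding.subtype _) := by
        ext x
        simp [and_comm]
      rw [h2, sum_map]
      exact sum_congr rfl fun x _ => by
        rw [Function.Embedding.subtype_apply, hφ x x.2]
    have h3 : ∑ x ∈ Y' with x ∈ S, ((χ' x : ℤ) : ℝ) =
        ∑ x ∈ Y with x ∈ S, if φ x = 0 then ((χ' x : ℤ) : ℝ) else 0 := by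
      rw [← sum_filter, filter_filter, filter_filter]
      refine sum_congr ?_ fun _ _ => rfl
      ext x
      simp only [mem_filter]
      tauto
    rw [h1, h3, ← sum_add_distrib]
    refine sum_congr rfl fun x hx => ?_
    have hxY := (mem_filter.1 hx).1
    have h4 := hψ ⟨x, hxY⟩
    rw [← hφ x hxY] at h4
    rcases h4 with h | h | h <;> rw [h] <;> simp
  rw [hsplit]
  have h1 := hdisc _ (mem_image_of_mem (fun S => S.subtype (· ∈ Y)) hS)
  have h2 := hχ' S hS
  have h3 : (#Y' : ℝ) ^ e ≤ r * (#Y : ℝ) ^ e := by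
    rw [← mul_rpow (by norm_num) (Nat.cast_nonneg _)]
    refine rpow_le_rpow (Nat.cast_nonneg _) ?_ he.le
    have : (10 * #Y' : ℝ) ≤ 9 * #Y := by exact_mod_cast hY'
    linarith
  have h4 : C₁ / (1 - r) * (#Y' : ℝ) ^ e ≤ C₁ / (1 - r) * (r * (#Y : ℝ) ^ e) :=
    mul_le_mul_of_nonneg_left h3 (by positivity)
  refine (abs_add_le _ _).trans ((add_le_add h1 (h2.trans h4)).trans_eq ?_)
  field_simp
  ring

end Iteration

end KineticDiscrepancy

namespace KineticDiscrepancy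

open Finset

/-! ### Vector configurations in general position -/

section GeneralPosition

variable {m d : ℕ}

/-- Any `d + 1` of the given vectors in `(d + 1)`-dimensional space are linearly independent. -/
def InGeneralPosition (V : Fin m → Fin (d + 1) → ℝ) : Prop :=
  ∀ f : Fin (d + 1) → Fin m, Function.Injective f → (Matrix.of fun j => V (f j)).det ≠ 0

theorem InGeneralPosition.eq_zero {V : Fin m → Fin (d + 1) → ℝ} (hV : InGeneralPosition V)
    {f : Fin (d + 1) → Fin m} (hf : Function.Injective f) {r : Fin (d + 1) → ℝ}
    (hr : ∀ j, V (f j) ⬝ᵥ r = 0) : r = 0 :=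
  Matrix.eq_zero_of_mulVec_eq_zero (hV f hf) (funext hr)

theorem InGeneralPosition.card_zeros_le {V : Fin m → Fin (d + 1) → ℝ} (hV : InGeneralPosition V)
    {r : Fin (d + 1) → ℝ} (hr : r ≠ 0) : #{i | V i ⬝ᵥ r = 0} ≤ d := by
  by_contra! hlt
  obtain ⟨Z, hZ, hcard⟩ := exists_subset_card_eq (Nat.succ_le_of_lt hlt)
  refine hr (hV.eq_zero (Z.orderEmbOfFin hcard).injective fun j => ?_)
  exact (mem_filter.1 (hZ (orderEmbOfFin_mem Z hcard j))).2

/-- At most `d` homogeneous equations in `d + 1` unknowns. Orthogonality to `r` will keep `r + τ •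
w` away from zero. -/
theorem exists_orthogonal (Z : Finset (Fin m)) (hZ : #Z < d) (V : Fin m → Fin (d + 1) → ℝ)
    (r : Fin (d + 1) → ℝ) : ∃ w ≠ 0, (∀ i ∈ Z, V i ⬝ᵥ w = 0) ∧ r ⬝ᵥ w = 0 := by
  set φ : (Fin (d + 1) → ℝ) →ₗ[ℝ] (Z → ℝ) × ℝ :=
    (Matrix.mulVecLin (Matrix.of fun i : Z => V i)).prod
      ((LinearMap.proj 0).comp (Matrix.mulVecLin (Matrix.of fun _ : Fin 1 => r)))
  have hker : LinearMap.ker φ ≠ ⊥ := LinearMap.ker_ne_bot_of_finrank_lt (by simp; omega)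
  obtain ⟨w, hw, hw0⟩ := Submodule.exists_mem_ne_zero_of_ne_bot hker
  have h := LinearMap.mem_ker.1 hw
  exact ⟨w, hw0, fun i hi => congrFun (congrArg Prod.fst h) ⟨i, hi⟩, congrArg Prod.snd h⟩

/-- A cell of a simple central arrangement has an extreme ray. -/
theorem InGeneralPosition.exists_ray {V : Fin m → Fin (d + 1) → ℝ} (hV : InGeneralPosition V)
    (hm : d + 1 ≤ m) {e : Fin m → ℝ} {l : Fin (d + 1) → ℝ} (hl : ∀ i, 0 < e i * (V i ⬝ᵥ l)) :
    ∃ f : Fin d → Fin m, Function.Injective f ∧ ∃ r, (∀ j, V (f j) ⬝ᵥ r = 0) ∧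
      ∀ i, i ∉ Set.range f → 0 < e i * (V i ⬝ᵥ r) := by
  classical
  set Z : (Fin (d + 1) → ℝ) → Finset (Fin m) := fun r => {i | V i ⬝ᵥ r = 0}
  set A : Set (Fin (d + 1) → ℝ) := {r | r ≠ 0 ∧ ∀ i, 0 ≤ e i * (V i ⬝ᵥ r)}
  have hlA : l ∈ A := by
    refine ⟨?_, fun i => (hl i).le⟩
    rintro rfl
    simpa using hl ⟨0, by omega⟩
  -- A nonzero point of the closed cell on the most hyperplanes lies on exactly `d`. With fewer, it
  -- could slide inside their intersection until it meets another one.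
  obtain ⟨r, hrA, hmax⟩ : ∃ r ∈ A, ∀ r' ∈ A, #(Z r') ≤ #(Z r) := by
    have hfin : ((fun r => #(Z r)) '' A).Finite :=
      (Set.finite_Iic m).subset (by
        rintro _ ⟨r, -, rfl⟩
        exact (card_le_univ _).trans_eq (Fintype.card_fin m))
    obtain ⟨_, ⟨⟨r, hr, rfl⟩, h⟩⟩ := hfin.exists_maximal ⟨_, l, hlA, rfl⟩
    refine ⟨r, hr, fun r' hr' => ?_⟩
    by_contra! hlt
    exact absurd (h ⟨r', hr', rfl⟩ hlt.le) (not_le.2 hlt)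
  have hcard : #(Z r) = d := by
    refine le_antisymm (hV.card_zeros_le hrA.1) ?_
    by_contra! hlt
    obtain ⟨w, hw0, hwZ, hrw⟩ : ∃ w ≠ 0, (∀ i ∈ Z r, V i ⬝ᵥ w = 0) ∧ r ⬝ᵥ w = 0 :=
      exists_orthogonal _ hlt V r
    obtain ⟨w, hwZ, hrw, i₀, hi₀⟩ : ∃ w, (∀ i ∈ Z r, V i ⬝ᵥ w = 0) ∧ r ⬝ᵥ w = 0 ∧
        ∃ i, e i * (V i ⬝ᵥ w) < 0 := by
      obtain ⟨i, hi⟩ : ∃ i, e i * (V i ⬝ᵥ w) ≠ 0 := by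
        by_contra! hall
        refine hw0 (hV.eq_zero (Fin.castLE_injective hm) fun j => ?_)
        have h1 := hl (Fin.castLE hm j)
        exact (mul_eq_zero.1 (hall _)).resolve_left (left_ne_zero_of_mul h1.ne')
      rcases lt_or_gt_of_ne hi with h | h
      · exact ⟨w, hwZ, hrw, i, h⟩
      · refine ⟨-w, fun j hj => ?_, ?_, i, ?_⟩
        · rw [dotProduct_neg, hwZ j hj, neg_zero]
        · rw [dotProduct_neg, hrw, neg_zero]
        · rw [dotProduct_neg]
          linarith
    set I : Finset (Fin m) := {i | e i * (V i ⬝ᵥ w) < 0}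
    obtain ⟨i₁, hi₁, hmin⟩ := exists_min_image I
      (fun i => e i * (V i ⬝ᵥ r) / -(e i * (V i ⬝ᵥ w))) ⟨i₀, by simpa [I] using hi₀⟩
    set τ := e i₁ * (V i₁ ⬝ᵥ r) / -(e i₁ * (V i₁ ⬝ᵥ w))
    have hi₁' : e i₁ * (V i₁ ⬝ᵥ w) < 0 := (mem_filter.1 hi₁).2
    have hτ : 0 ≤ τ := div_nonneg (hrA.2 i₁) (by linarith)
    have hdot : ∀ i, V i ⬝ᵥ (r + τ • w) = V i ⬝ᵥ r + τ * (V i ⬝ᵥ w) := fun i => by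
      rw [dotProduct_add, dotProduct_smul, smul_eq_mul]
    have hmem : r + τ • w ∈ A := by
      refine ⟨fun h0 => hrA.1 ?_, fun i => ?_⟩
      · have h1 : r ⬝ᵥ (r + τ • w) = r ⬝ᵥ r := by
          rw [dotProduct_add, dotProduct_smul, hrw, smul_zero, add_zero]
        rw [h0, dotProduct_zero] at h1
        exact dotProduct_self_eq_zero.1 h1.symm
      · rw [hdot]
        by_cases hi : i ∈ I
        · have h1 := hmin i hi
          rw [le_div_iff₀ (by have := (mem_filter.1 hi).2; linarith)] at h1
          linarith
        · have h1 : 0 ≤ e i * (V i ⬝ᵥ w) := by simpa [I] using hi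
          have := hrA.2 i
          nlinarith [mul_nonneg hτ h1]
    have hi₁Z : i₁ ∉ Z r := fun h => by
      rw [hwZ i₁ h, mul_zero] at hi₁'
      exact lt_irrefl _ hi₁'
    have hsub : insert i₁ (Z r) ⊆ Z (r + τ • w) := by
      intro i hi
      simp only [Z, mem_filter, mem_univ, true_and]
      rw [hdot]
      rcases mem_insert.1 hi with rfl | h
      · have h1 : e i * (V i ⬝ᵥ r) + τ * (e i * (V i ⬝ᵥ w)) = 0 := by
          simp only [τ]
          rw [div_neg, neg_mul, div_mul_cancel₀ _ hi₁'.ne, add_neg_cancel]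
        have h2 : e i ≠ 0 := left_ne_zero_of_mul hi₁'.ne
        have h3 : e i * (V i ⬝ᵥ r + τ * (V i ⬝ᵥ w)) = 0 := by linarith
        exact (mul_eq_zero.1 h3).resolve_left h2
      · rw [hwZ i h, (mem_filter.1 h).2, mul_zero, add_zero]
    have h1 := card_le_card hsub
    rw [card_insert_of_notMem hi₁Z] at h1
    have := hmax _ hmem
    omega
  refine ⟨(Z r).orderEmbOfFin hcard, ((Z r).orderEmbOfFin hcard).injective, r, fun j => ?_,
    fun i hi => ?_⟩
  · exact (mem_filter.1 (orderEmbOfFin_mem (Z r) hcard j)).2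
  · rw [range_orderEmbOfFin] at hi
    refine lt_of_le_of_ne (hrA.2 i) (Ne.symm (mul_ne_zero (left_ne_zero_of_mul (hl i).ne') ?_))
    simpa [Z] using hi

/-- The generalized cross product of `d` vectors, as a functional. -/
theorem exists_cross (A : Fin d → Fin (d + 1) → ℝ) : ∃ u : Fin (d + 1) → ℝ, ∀ x,
    (Matrix.of (Fin.cons x A : Fin (d + 1) → Fin (d + 1) → ℝ)).det = x ⬝ᵥ u := by
  refine ⟨fun j => (-1) ^ (j : ℕ) * ((Matrix.of A).submatrix id j.succAbove).det, fun x => ?_⟩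
  rw [Matrix.det_succ_row_zero, dotProduct]
  refine sum_congr rfl fun j _ => ?_
  rw [mul_comm (x j), mul_right_comm]
  rfl

/-- The signs of a cell of a simple central arrangement are given by determinants. -/
theorem InGeneralPosition.exists_det_sign {V : Fin m → Fin (d + 1) → ℝ}
    (hV : InGeneralPosition V) (hm : d + 1 ≤ m) {e : Fin m → ℝ} {l : Fin (d + 1) → ℝ}
    (hl : ∀ i, 0 < e i * (V i ⬝ᵥ l)) :
    ∃ f : Fin d → Fin m, ∃ c : ℝ, ∀ i, i ∉ Set.range f →
      0 < e i * (c * (Matrix.of (Fin.cons (V i) fun j => V (f j) :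
        Fin (d + 1) → Fin (d + 1) → ℝ)).det) := by
  obtain ⟨f, hf, r, hr0, hr⟩ := hV.exists_ray hm hl
  obtain ⟨u, hu⟩ := exists_cross fun j => V (f j)
  obtain ⟨i₀, hi₀⟩ : ∃ i, i ∉ Set.range f := by
    by_contra! hall
    have h := Fintype.card_le_of_surjective f hall
    simp at h
    omega
  have hinj : Function.Injective (Fin.cons i₀ f : Fin (d + 1) → Fin m) :=
    Fin.cons_injective_iff.2 ⟨hi₀, hf⟩
  have hcons : ∀ i, (Matrix.of fun j => V ((Fin.cons i f : Fin (d + 1) → Fin m) j)) =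
      Matrix.of (Fin.cons (V i) fun j => V (f j) : Fin (d + 1) → Fin (d + 1) → ℝ) := fun i => by
    congr 1
    funext j
    refine Fin.cases ?_ (fun j => ?_) j <;> simp
  have hdet : V i₀ ⬝ᵥ u ≠ 0 := by
    rw [← hu, ← hcons]
    exact hV _ hinj
  have hu0 : ∀ j, V (f j) ⬝ᵥ u = 0 := fun j => by
    rw [← hu]
    exact Matrix.det_zero_of_row_eq (i := 0) (j := j.succ) (Fin.succ_ne_zero j).symm
      rfl
  -- The ray and the cross product are proportional: this combination is orthogonal to the `V (f j)`
  -- and to `V i₀`, which are `d + 1` independent vectors.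
  have hprop : (V i₀ ⬝ᵥ u) • r - (V i₀ ⬝ᵥ r) • u = 0 := by
    refine hV.eq_zero hinj fun j => ?_
    rw [dotProduct_sub, dotProduct_smul, dotProduct_smul, smul_eq_mul, smul_eq_mul]
    refine Fin.cases ?_ (fun j => ?_) j
    · rw [Fin.cons_zero]
      ring
    · rw [Fin.cons_succ, hr0, hu0]
      ring
  refine ⟨f, (V i₀ ⬝ᵥ r) / (V i₀ ⬝ᵥ u), fun i hi => ?_⟩
  have h1 : r = ((V i₀ ⬝ᵥ r) / (V i₀ ⬝ᵥ u)) • u := by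
    rw [sub_eq_zero] at hprop
    rw [div_eq_inv_mul, mul_smul, ← hprop, smul_smul, inv_mul_cancel₀ hdet, one_smul]
  have h2 := hr i hi
  rw [h1, dotProduct_smul, smul_eq_mul] at h2
  rwa [hu]

end GeneralPosition

end KineticDiscrepancy

namespace KineticDiscrepancy

open Finset Polynomial

/-! ### Counting the sign patterns of moving vectors -/

section CountingTraces

variable {m d : ℕ}

/-- The number of distinct real roots of `p` below `t`. -/
noncomputable def rootsBelow (p : ℝ[X]) (t : ℝ) : ℕ := #{x ∈ p.roots.toFinset | x < t}

theorem rootsBelow_le (p : ℝ[X]) (t : ℝ) : rootsBelow p t ≤ p.natDegree :=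
  (card_filter_le _ _).trans ((Multiset.toFinset_card_le _).trans p.card_roots')

/-- A sign change of `p` would give a root of `q` between the two times, and the root counts would
differ. One count for a product thus fixes the signs of all its factors. -/
theorem eval_mul_eval_pos {p q : ℝ[X]} (hpq : p ∣ q) {t t' : ℝ} (ht : q.eval t ≠ 0)
    (ht' : q.eval t' ≠ 0) (h : rootsBelow q t = rootsBelow q t') : 0 < p.eval t * p.eval t' := by
  wlog hle : t ≤ t' generalizing t t'
  · rw [mul_comm]
    exact this ht' ht h.symm (le_of_not_ge hle)
  by_contra! hneg
  have h0 : (0 : ℝ) ∈ Set.uIcc (p.eval t) (p.eval t') := by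
    rw [Set.mem_uIcc]
    rcases mul_nonpos_iff.1 hneg with h | h
    · exact Or.inr ⟨h.2, h.1⟩
    · exact Or.inl h
  obtain ⟨x, hx, hpx⟩ := intermediate_value_uIcc p.continuous.continuousOn h0
  rw [Set.uIcc_of_le hle] at hx
  have hqx : q.eval x = 0 := eval_eq_zero_of_dvd_of_eval_eq_zero hpq hpx
  have hxt : x < t' := lt_of_le_of_ne hx.2 fun he => ht' (he ▸ hqx)
  have hsub : q.roots.toFinset.filter (· < t) ⊆ q.roots.toFinset.filter (· < t') :=
    monotone_filter_right _ fun y _ hy => lt_of_lt_of_le hy hle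
  have heq := eq_of_subset_of_card_le hsub h.ge
  have hmem : x ∈ q.roots.toFinset.filter (· < t') := by
    rw [mem_filter, Multiset.mem_toFinset, mem_roots (fun h0 => ht (by simp [h0]))]
    exact ⟨hqx, hxt⟩
  rw [← heq, mem_filter] at hmem
  exact absurd hmem.2 (not_lt.2 hx.1)

theorem natDegree_det_le {n s : ℕ} (M : Matrix (Fin n) (Fin n) ℝ[X])
    (hM : ∀ i j, (M i j).natDegree ≤ s) : M.det.natDegree ≤ n * s := by
  rw [Matrix.det_apply]
  refine natDegree_sum_le_of_forall_le _ _ fun τ _ => (natDegree_smul_le _ _).trans ?_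
  refine (natDegree_prod_le _ _).trans ((sum_le_sum fun i _ => hM _ _).trans ?_)
  simp

/-- The linear functional `l` is negative on the vectors with index in `S` and positive on the
other ones. -/
def StrictlyRealizes (V : Fin m → Fin (d + 1) → ℝ) (S : Finset (Fin m)) (l : Fin (d + 1) → ℝ) :
    Prop := ∀ i, (i ∈ S → V i ⬝ᵥ l < 0) ∧ (i ∉ S → 0 < V i ⬝ᵥ l)

/-- The determinant whose sign tells on which side of the hyperplane spanned by the moving vectors
`v (f j)` the moving vector `v i` lies. -/
noncomputable def sidePoly (v : Fin m → Fin (d + 1) → ℝ[X]) (f : Fin d → Fin m) (i : Fin m) : ℝ[X] :=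
  (Matrix.of (Fin.cons (v i) fun j => v (f j) : Fin (d + 1) → Fin (d + 1) → ℝ[X])).det

theorem eval_sidePoly (v : Fin m → Fin (d + 1) → ℝ[X]) (f : Fin d → Fin m) (i : Fin m) (t : ℝ) :
    (sidePoly v f i).eval t = (Matrix.of (Fin.cons (fun k => (v i k).eval t)
      fun j k => (v (f j) k).eval t : Fin (d + 1) → Fin (d + 1) → ℝ)).det := by
  rw [sidePoly, ← coe_evalRingHom, RingHom.map_det]
  congr 1
  ext j k
  refine Fin.cases ?_ (fun j => ?_) j <;> rfl

theorem natDegree_sidePoly_le {v : Fin m → Fin (d + 1) → ℝ[X]} {s : ℕ}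
    (hv : ∀ i j, (v i j).natDegree ≤ s) (f : Fin d → Fin m) (i : Fin m) :
    (sidePoly v f i).natDegree ≤ (d + 1) * s :=
  natDegree_det_le _ fun j k => by
    refine Fin.cases ?_ (fun j => ?_) j
    · exact hv _ _
    · exact hv _ _

theorem card_le_of_generic {v : Fin m → Fin (d + 1) → ℝ[X]} {s : ℕ}
    (hv : ∀ i j, (v i j).natDegree ≤ s) (hm : d + 1 ≤ m) (𝒮 : Finset (Finset (Fin m)))
    (h𝒮 : ∀ S ∈ 𝒮, ∃ t l, InGeneralPosition (fun i j => (v i j).eval t) ∧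
      StrictlyRealizes (fun i j => (v i j).eval t) S l) :
    #𝒮 ≤ m ^ d * (2 * (2 ^ d * (m * ((d + 1) * s) + 1))) := by
  classical
  have key : ∀ S ∈ 𝒮, ∃ (t : ℝ) (f : Fin d → Fin m) (c : ℝ), ∀ i, i ∉ Set.range f →
      0 < (if i ∈ S then -1 else 1) * (c * (sidePoly v f i).eval t) := by
    intro S hS
    obtain ⟨t, l, hgen, hreal⟩ := h𝒮 S hS
    obtain ⟨f, c, hfc⟩ := hgen.exists_det_sign hm (e := fun i => if i ∈ S then -1 else 1) (l := l)
      fun i => by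
        by_cases hi : i ∈ S
        · simpa [hi] using (hreal i).1 hi
        · simpa [hi] using (hreal i).2 hi
    refine ⟨t, f, c, fun i hi => ?_⟩
    rw [eval_sidePoly]
    exact hfc i hi
  have : Nonempty (Fin m) := ⟨⟨0, by omega⟩⟩
  choose! t f c hc using key
  set G : (Fin d → Fin m) → ℝ[X] := fun f => ∏ i with i ∉ Set.range f, sidePoly v f i
  have hG : ∀ f, (G f).natDegree ≤ m * ((d + 1) * s) := fun f => by
    refine (natDegree_prod_le _ _).trans ((sum_le_sum fun i _ => natDegree_sidePoly_le hv f i).trans ?_)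
    rw [sum_const, smul_eq_mul]
    exact Nat.mul_le_mul_right _ ((card_le_univ _).trans_eq (Fintype.card_fin m))
  have hGt : ∀ S ∈ 𝒮, (G (f S)).eval (t S) ≠ 0 := fun S hS => by
    rw [eval_prod, prod_ne_zero_iff]
    intro i hi
    exact right_ne_zero_of_mul (right_ne_zero_of_mul (hc S hS i (mem_filter.1 hi).2).ne')
  -- The tuple spanning the hyperplane, the sign of its scalar, the membership of the indices on the
  -- hyperplane, where the determinants vanish, and the time interval between roots together
  -- determine `S`.
  set code : Finset (Fin m) → (Fin d → Fin m) × Bool × (Fin d → Bool) × ℕ := fun S =>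
    (f S, decide (0 < c S), fun j => decide (f S j ∈ S), rootsBelow (G (f S)) (t S))
  have hcard := card_le_card_of_injOn (s := 𝒮) (t := (univ : Finset (Fin d → Fin m)) ×ˢ
    ((univ : Finset Bool) ×ˢ ((univ : Finset (Fin d → Bool)) ×ˢ
      Finset.range (m * ((d + 1) * s) + 1)))) code
    (fun S _ => by
      simp only [code, mem_coe, mem_product, mem_univ, true_and, mem_range]
      exact Nat.lt_succ_of_le ((rootsBelow_le _ _).trans (hG _))) (by
      intro S hS T hT he
      simp only [code, Prod.mk.injEq] at he
      obtain ⟨hf, hsign, hbits, hroots⟩ := he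
      rw [decide_eq_decide] at hsign
      ext i
      by_cases hi : i ∈ Set.range (f S)
      · obtain ⟨j, rfl⟩ := hi
        have := congrFun hbits j
        rw [decide_eq_decide, ← hf] at this
        exact this
      · have h1 := hc S hS i hi
        have h2 := hc T hT i (hf ▸ hi)
        have hGT := hGt T hT
        rw [← hf] at h2 hroots hGT
        have h3 := eval_mul_eval_pos (p := sidePoly v (f S) i) (q := G (f S))
          (dvd_prod_of_mem _ (mem_filter.2 ⟨mem_univ i, hi⟩)) (hGt S hS) hGT hroots
        have h4 : 0 < c S * c T := by
          have h5 : c S ≠ 0 := left_ne_zero_of_mul (right_ne_zero_of_mul h1.ne')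
          have h6 : c T ≠ 0 := left_ne_zero_of_mul (right_ne_zero_of_mul h2.ne')
          rcases lt_or_gt_of_ne h5 with h | h
          · have h7 : c T < 0 := lt_of_le_of_ne (not_lt.1 fun h' => not_lt.2 h.le (hsign.2 h')) h6
            exact mul_pos_of_neg_of_neg h h7
          · exact mul_pos h (hsign.1 h)
        have h5 := mul_pos h4 h3
        by_cases hiS : i ∈ S <;> by_cases hiT : i ∈ T <;> simp only [hiS, hiT, if_true, if_false] at h1 h2 ⊢ <;>
          nlinarith)
  simpa using hcard

theorem eventually_eval_ne_zero {p : ℝ[X]} (hp : p ≠ 0) (a : ℝ) :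
    ∀ᶠ x in nhdsWithin a {a}ᶜ, p.eval x ≠ 0 := by
  have hfin : ((p.roots.toFinset : Set ℝ) \ {a}).Finite := p.roots.toFinset.finite_toSet.sdiff
  have h1 : ∀ᶠ x in nhds a, x ∉ (p.roots.toFinset : Set ℝ) \ {a} :=
    hfin.isClosed.isOpen_compl.mem_nhds (by simp)
  filter_upwards [h1.filter_mono nhdsWithin_le_nhds, self_mem_nhdsWithin] with x hx hxa h0
  exact hx ⟨by simpa [hp] using h0, hxa⟩

theorem StrictlyRealizes.eventually {X : Type*} [TopologicalSpace X]
    {V : X → Fin m → Fin (d + 1) → ℝ} {a : X} (hV : ∀ i j, ContinuousAt (fun x => V x i j) a)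
    {S : Finset (Fin m)} {l : X → Fin (d + 1) → ℝ} (hl : ∀ j, ContinuousAt (fun x => l x j) a)
    (h : StrictlyRealizes (V a) S (l a)) : ∀ᶠ x in nhds a, StrictlyRealizes (V x) S (l x) := by
  have hcont : ∀ i, ContinuousAt (fun x => V x i ⬝ᵥ l x) a := fun i => by
    unfold dotProduct
    exact tendsto_finsetSum _ fun j _ => (hV i j).mul (hl j)
  refine Filter.eventually_all.2 fun i => ?_
  by_cases hi : i ∈ S
  · filter_upwards [(hcont i).eventually (gt_mem_nhds ((h i).1 hi))] with x hx
    exact ⟨fun _ => hx, fun h => absurd hi h⟩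
  · filter_upwards [(hcont i).eventually (lt_mem_nhds ((h i).2 hi))] with x hx
    exact ⟨fun h => absurd h hi, fun _ => hx⟩

/-- A general position perturbation, of the moving vectors and of the times, that keeps a given
finite collection of strictly realized sets. -/
theorem exists_generic_perturbation {v : Fin m → Fin (d + 1) → ℝ[X]} {s : ℕ}
    (hv : ∀ i j, (v i j).natDegree ≤ s) (𝒮 : Finset (Finset (Fin m)))
    (h𝒮 : ∀ S ∈ 𝒮, ∃ t l, StrictlyRealizes (fun i j => (v i j).eval t) S l) :
    ∃ v' : Fin m → Fin (d + 1) → ℝ[X], (∀ i j, (v' i j).natDegree ≤ s) ∧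
      ∀ S ∈ 𝒮, ∃ t l, InGeneralPosition (fun i j => (v' i j).eval t) ∧
        StrictlyRealizes (fun i j => (v' i j).eval t) S l := by
  choose! t l htl using h𝒮
  -- Moving along the moment curve changes only constant terms, so degrees stay at most `s`. At time
  -- `0` each relevant determinant is a polynomial in `ε` whose top coefficient is a nonzero
  -- Vandermonde determinant.
  set w : ℝ → Fin m → Fin (d + 1) → ℝ[X] := fun ε i j => v i j + C (ε * ((i : ℕ) : ℝ) ^ (j : ℕ))
  have hw : ∀ ε i j, (w ε i j).natDegree ≤ s := fun ε i j =>
    natDegree_add_le_of_degree_le (hv i j) ((natDegree_C _).trans_le (Nat.zero_le _))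
  have h1 : ∀ᶠ ε in nhdsWithin (0 : ℝ) {0}ᶜ, ∀ S ∈ 𝒮,
      StrictlyRealizes (fun i j => (w ε i j).eval (t S)) S (l S) := by
    refine ((Filter.eventually_all_finset 𝒮).2 fun S hS => ?_).filter_mono nhdsWithin_le_nhds
    refine StrictlyRealizes.eventually (V := fun ε i j => (w ε i j).eval (t S))
      (l := fun _ => l S) (fun i j => ?_) (fun j => continuousAt_const) ?_
    · simp only [w, eval_add, eval_C]
      fun_prop
    · simpa [w] using htl S hS
  have h2 : ∀ᶠ ε in nhdsWithin (0 : ℝ) {0}ᶜ, InGeneralPosition fun i j => (w ε i j).eval 0 := by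
    refine Filter.eventually_all.2 fun f => ?_
    by_cases hf : Function.Injective f
    · set A : Matrix (Fin (d + 1)) (Fin (d + 1)) ℝ := Matrix.vandermonde fun j => ((f j : ℕ) : ℝ)
      set B : Matrix (Fin (d + 1)) (Fin (d + 1)) ℝ := Matrix.of fun j k => (v (f j) k).eval 0
      have hA : A.det ≠ 0 := Matrix.det_vandermonde_ne_zero_iff.2 fun j k hjk =>
        hf (Fin.ext (by exact_mod_cast hjk))
      have hp : ((X : ℝ[X]) • A.map C + B.map C).det ≠ 0 := fun h0 => by
        have := coeff_det_X_add_C_card A B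
        rw [h0, coeff_zero] at this
        exact hA this.symm
      filter_upwards [eventually_eval_ne_zero hp 0] with ε hε _
      rw [← coe_evalRingHom, RingHom.map_det] at hε
      convert hε using 2
      ext j k
      simp [A, B, w, Matrix.vandermonde_apply, add_comm]
    · exact Filter.Eventually.of_forall fun _ h => absurd h hf
  obtain ⟨ε, hε, hε'⟩ := (h1.and h2).exists
  refine ⟨w ε, hw ε, fun S hS => ?_⟩
  have h3 : ∀ᶠ x in nhdsWithin (t S) {t S}ᶜ, StrictlyRealizes (fun i j => (w ε i j).eval x) S (l S) :=
    (StrictlyRealizes.eventually (V := fun x i j => (w ε i j).eval x) (l := fun _ => l S)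
      (fun i j => (w ε i j).continuous.continuousAt) (fun j => continuousAt_const)
      (hε S hS)).filter_mono nhdsWithin_le_nhds
  have h4 : ∀ᶠ x in nhdsWithin (t S) {t S}ᶜ, InGeneralPosition fun i j => (w ε i j).eval x := by
    refine Filter.eventually_all.2 fun f => ?_
    by_cases hf : Function.Injective f
    · have heval : ∀ x, ((Matrix.of fun j => w ε (f j)).det).eval x =
          (Matrix.of fun j k => (w ε (f j) k).eval x).det := fun x => by
        rw [← coe_evalRingHom, RingHom.map_det]
        rfl
      -- General position at time `0` makes the determinant a nonzero polynomial in time, so all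
      -- times near `t S` other than `t S` avoid its roots.
      have hp : (Matrix.of fun j => w ε (f j)).det ≠ 0 := fun h0 => by
        have := heval 0
        rw [h0, eval_zero] at this
        exact hε' f hf this.symm
      filter_upwards [eventually_eval_ne_zero hp (t S)] with x hx _
      rwa [heval] at hx
    · exact Filter.Eventually.of_forall fun _ h => absurd h hf
  obtain ⟨x, hx, hx'⟩ := (h3.and h4).exists
  exact ⟨x, l S, hx', hx⟩

/-- The number of sets strictly realized by moving vectors. -/
theorem card_le_of_strictlyRealizes {v : Fin m → Fin (d + 1) → ℝ[X]} {s : ℕ}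
    (hv : ∀ i j, (v i j).natDegree ≤ s) (𝒮 : Finset (Finset (Fin m)))
    (h𝒮 : ∀ S ∈ 𝒮, ∃ t l, StrictlyRealizes (fun i j => (v i j).eval t) S l) :
    #𝒮 ≤ 2 ^ (d + 1) * ((d + 1) * s + 1) * (m + 1) ^ (d + 1) := by
  rcases lt_or_ge m (d + 1) with hm | hm
  -- With fewer than `d + 1` vectors there need be no extreme ray; the number of all subsets is
  -- small enough.
  · calc #𝒮 ≤ 2 ^ m := (card_le_univ _).trans_eq (by simp)
      _ ≤ 2 ^ (d + 1) * 1 * 1 := by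
        rw [mul_one, mul_one]
        exact Nat.pow_le_pow_right (by norm_num) hm.le
      _ ≤ _ := by
        gcongr
        · omega
        · exact Nat.one_le_pow _ _ (by omega)
  · obtain ⟨v', hv', h'⟩ := exists_generic_perturbation hv 𝒮 h𝒮
    refine (card_le_of_generic hv' hm 𝒮 h').trans ?_
    calc m ^ d * (2 * (2 ^ d * (m * ((d + 1) * s) + 1)))
        ≤ (m + 1) ^ d * (2 * (2 ^ d * ((m + 1) * ((d + 1) * s + 1)))) := by
          gcongr
          · omega
          · nlinarith
      _ = _ := by ring

end CountingTraces

end KineticDiscrepancy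

namespace KineticDiscrepancy

open Finset Polynomial

/-! ### The kinetic hypergraph of halfspaces -/

section Halfspaces

/-- The homogeneous coordinates of a moving point. -/
noncomputable def MovingPoint.lift {d : ℕ} (p : MovingPoint d) : Fin (d + 1) → ℝ[X] := Fin.cons 1 p

theorem MovingPoint.lift_dotProduct {d : ℕ} (p : MovingPoint d) (t b : ℝ)
    (a : EuclideanSpace ℝ (Fin d)) :
    (fun j => (p.lift j).eval t) ⬝ᵥ (Fin.cons (-b) a.ofLp : Fin (d + 1) → ℝ) =
      inner ℝ a (p.pos t) - b := by
  simp [dotProduct, Fin.sum_univ_succ, MovingPoint.lift, MovingPoint.pos, PiLp.inner_apply]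
  ring

/-- Only finitely many points matter, so the threshold can be raised slightly for a closed halfspace
or lowered for an open one until no point lies on the boundary. -/
theorem exists_strictlyRealizes {d m : ℕ} (p : Fin m → MovingPoint d) (t : ℝ)
    {r : Set (EuclideanSpace ℝ (Fin d))} (hr : r ∈ halfspaces d) {S : Finset (Fin m)}
    (hS : ∀ i, i ∈ S ↔ (p i).pos t ∈ r) :
    ∃ l, StrictlyRealizes (fun i j => ((p i).lift j).eval t) S l := by
  obtain ⟨a, b, -, h⟩ := hr
  suffices ∃ b' : ℝ, ∀ i, (i ∈ S → inner ℝ a ((p i).pos t) < b') ∧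
      (i ∉ S → b' < inner ℝ a ((p i).pos t)) by
    obtain ⟨b', hb'⟩ := this
    refine ⟨Fin.cons (-b') a.ofLp, fun i => ?_⟩
    rw [MovingPoint.lift_dotProduct, sub_neg, sub_pos]
    exact hb' i
  rcases h with rfl | rfl
  · have h1 : ∀ᶠ b' in nhdsWithin b (Set.Ioi b), ∀ i, (i ∈ S → inner ℝ a ((p i).pos t) < b') ∧
        (i ∉ S → b' < inner ℝ a ((p i).pos t)) := by
      refine Filter.eventually_all.2 fun i => ?_
      have hi : i ∈ S ↔ inner ℝ a ((p i).pos t) ≤ b := hS i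
      by_cases hiS : i ∈ S
      · filter_upwards [self_mem_nhdsWithin] with b' hb'
        exact ⟨fun _ => (hi.1 hiS).trans_lt hb', fun h => absurd hiS h⟩
      · filter_upwards [(gt_mem_nhds (not_le.1 (mt hi.2 hiS))).filter_mono nhdsWithin_le_nhds]
          with b' hb'
        exact ⟨fun h => absurd h hiS, fun _ => hb'⟩
    exact h1.exists
  · have h1 : ∀ᶠ b' in nhdsWithin b (Set.Iio b), ∀ i, (i ∈ S → inner ℝ a ((p i).pos t) < b') ∧
        (i ∉ S → b' < inner ℝ a ((p i).pos t)) := by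
      refine Filter.eventually_all.2 fun i => ?_
      have hi : i ∈ S ↔ inner ℝ a ((p i).pos t) < b := hS i
      by_cases hiS : i ∈ S
      · filter_upwards [(lt_mem_nhds (hi.1 hiS)).filter_mono nhdsWithin_le_nhds] with b' hb'
        exact ⟨fun _ => hb', fun h => absurd hiS h⟩
      · filter_upwards [self_mem_nhdsWithin] with b' hb'
        exact ⟨fun h => absurd h hiS, fun _ => lt_of_lt_of_le hb' (not_lt.1 (mt hi.2 hiS))⟩
    exact h1.exists

theorem shatterBound_halfspaces {d s : ℕ} {α : Type*} [DecidableEq α] (p : α → MovingPoint d)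
    (hp : ∀ x, (p x).HasDescriptionComplexity s) (F : Finset (Finset α))
    (hF : ∀ S ∈ F, ∃ t : ℝ, ∃ r ∈ halfspaces d, ∀ x, x ∈ S ↔ (p x).pos t ∈ r) :
    ShatterBound F (2 ^ (d + 1) * ((d + 1) * s + 1)) (d + 1) := by
  intro m a
  refine card_le_of_strictlyRealizes (v := fun i => (p (a i)).lift) (s := s) (fun i j => ?_) _ ?_
  · refine Fin.cases ?_ (fun j => ?_) j
    · simp [MovingPoint.lift]
    · exact hp (a i) j
  · intro T hT
    obtain ⟨S, hS, rfl⟩ := mem_image.1 hT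
    obtain ⟨t, r, hr, h⟩ := hF S hS
    exact ⟨t, exists_strictlyRealizes _ t hr fun i => by rw [mem_trace, h]⟩

theorem halfspaces_zero : halfspaces 0 = ∅ := by
  ext h
  simp only [halfspaces, Set.mem_ofPred_eq, Set.mem_empty_iff_false, iff_false]
  rintro ⟨a, -, ha, -⟩
  exact ha (Subsingleton.elim _ _)

end Halfspaces

end KineticDiscrepancy

/-! ### The discrepancy bound -/

open KineticDiscrepancy in
theorem mainTheorem7 (d s : ℕ) :
    ∃ C : ℝ, ∀ (n : ℕ) (P : Finset (KineticDiscrepancy.MovingPoint d)), P.card = n →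
      (∀ p ∈ P, p.HasDescriptionComplexity s) →
      (KineticDiscrepancy.disc
          (KineticDiscrepancy.kineticHypergraph (P : Set (KineticDiscrepancy.MovingPoint d))
            (KineticDiscrepancy.halfspaces d)) : ℝ)
        ≤ C * (n : ℝ) ^ ((1 : ℝ) / 2 - 1 / (2 * (d : ℝ) + 2)) := by
  classical
  -- Dimension zero would mean `D = 1`, outside the coloring theorem, but it has no halfspaces and
  -- hence no hyperedges.
  rcases Nat.eq_zero_or_pos d with rfl | hd
  · refine ⟨0, fun n P _ _ => ?_⟩
    have h : disc (kineticHypergraph (P : Set (MovingPoint 0)) (halfspaces 0)) ≤ 0 := by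
      refine (disc_le_iff P.finite_toSet 0).2 ⟨fun _ => 1, ?_⟩
      rintro S ⟨t, -, r, hr, -⟩
      rw [halfspaces_zero] at hr
      exact absurd hr (Set.notMem_empty r)
    rw [Nat.le_zero.1 h]
    simp
  obtain ⟨C, hC, hcol⟩ := exists_coloring_of_shatterBound
    (2 ^ (d + 1) * ((d + 1) * s + 1)) (d + 1) (by omega)
  refine ⟨C, fun n P hn hP => ?_⟩
  subst hn
  set F : Finset (Finset P) := Finset.univ.filter fun S =>
    ∃ t : ℝ, ∃ r ∈ halfspaces d, ∀ x, x ∈ S ↔ (x : MovingPoint d).pos t ∈ r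
  obtain ⟨χ, hχ⟩ := hcol F
    (shatterBound_halfspaces (fun x : P => (x : MovingPoint d)) (fun x => hP x x.2) F
      fun S hS => (Finset.mem_filter.1 hS).2) Finset.univ
  have hexp : (1 : ℝ) / 2 - 1 / (2 * ((d + 1 : ℕ) : ℝ)) = 1 / 2 - 1 / (2 * (d : ℝ) + 2) := by
    push_cast
    ring
  rw [hexp, Finset.card_univ, Fintype.card_coe] at hχ
  set B : ℝ := C * (P.card : ℝ) ^ ((1 : ℝ) / 2 - 1 / (2 * (d : ℝ) + 2))
  have hB : 0 ≤ B := by positivity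
  -- `disc_le_iff` takes a natural number as its bound, and imbalances are integers, so rounding
  -- down loses nothing.
  suffices h : disc (kineticHypergraph (P : Set (MovingPoint d)) (halfspaces d)) ≤ ⌊B⌋₊ from
    (Nat.cast_le.2 h).trans (Nat.floor_le hB)
  refine (disc_le_iff P.finite_toSet _).2
    ⟨fun p => if h : p ∈ P then χ ⟨p, h⟩ else 1, ?_⟩
  rintro _ ⟨t, -, r, hr, rfl⟩
  set S : Finset P := Finset.univ.filter fun x => (x : MovingPoint d).pos t ∈ r
  have h1 := hχ S (Finset.mem_filter.2 ⟨Finset.mem_univ _, t, r, hr, fun x => by simp [S]⟩)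
  have h2 : {p | p ∈ (P : Set (MovingPoint d)) ∧ p.pos t ∈ r} =
      (S.map (Function.Embedding.subtype _) : Set (MovingPoint d)) := by
    ext p
    simp [S, and_comm]
  have h3 : imbalance (fun p => if h : p ∈ P then χ ⟨p, h⟩ else 1)
      {p | p ∈ (P : Set (MovingPoint d)) ∧ p.pos t ∈ r} = ∑ x with x ∈ S, (χ x : ℤ) := by
    rw [imbalance, h2, finsum_mem_coe_finset, Finset.sum_map, Finset.filter_univ_mem]
    refine Finset.sum_congr rfl fun x _ => ?_
    rw [Function.Embedding.subtype_apply, dif_pos x.2]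
  rw [h3, Int.abs_eq_natAbs]
  refine Nat.cast_le.2 (Nat.le_floor ?_)
  rw [Nat.cast_natAbs, Int.cast_abs]
  push_cast
  exact h1
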